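/- Let $F=\mathbb C$ or, more generally, any field extension of $\mathbb C$ (for instance $\mathbb C(u)$ or $\mathbb C(u,v)$ with formal parameters); let $n\ge 0$ and $u,v\in F$. Let $W_{B_n}$ be the group of signed permutations of $1,\dots,n$, let $W_{D_n}\subseteq W_{B_n}$ be the subgroup of those with an even number of sign changes, and let $W_{A_{n-1}}=S_n\subseteq W_{B_n}$ be the subgroup of those without sign changes. For $i\ne j$ let $s_{ij}$ be the transposition of $i,j$, let $\bar s_{ij}$ be this transposition coupled with the sign changes at $i$ and $j$, and let $\tau_i$ be the sign change at $i$. Let $W$ be one of $W_{A_{n-1}},W_{D_n},W_{B_n}$. It acts on $\mathfrak h=\bigoplus_i F y_i$, on $\mathfrak h^*=\bigoplus_i F x_i$ and on the Clifford algebra $\mathcal C_n$ (generators $c_1,\dots,c_n$, relations $c_i^2=1$ and $c_ic_j=-c_jc_i$ for $i\neq j$) by signed permutation of the $y_i$, the $x_i$ and the $c_i$, respectively. The rational double affine Hecke–Clifford algebra $H_W$ is the $F$-algebra generated by $x_i,y_i,c_i$ $(1\le i\le n)$ and the group $W$, subject to the multiplication of $W$, the above relations among the $c_i$, and $$x_ix_j=x_jx_i,\quad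 y_iy_j=y_jy_i,\quad y_ic_j=c_jy_i\ (\forall i,j),\quad x_ic_i=-c_ix_i,\quad x_ic_j=c_jx_i\ (i\ne j),$$ $$wxw^{-1}=w(x),\quad wyw^{-1}=w(y),\quad wcw^{-1}=w(c)\qquad(w\in W,\ x\in\mathfrak h^*,\ y\in\mathfrak h,\ c\in\mathcal C_n),$$ together with the following commutators ($[a,b]=ab-ba$; $i\ne j$ in the formulas for $[y_j,x_i]$). * Type $A_{n-1}$: $[y_j,x_i]=u(1+c_jc_i)s_{ji}$ and $[y_i,x_i]=-u\sum_{k\ne i}(1+c_kc_i)s_{ki}$. * Type $D_n$: $[y_j,x_i]=u\big((1+c_jc_i)s_{ij}-(1-c_jc_i)\bar s_{ij}\big)$ and $[y_i,x_i]=-u\sum_{k\ne i}\big((1+c_kc_i)s_{ki}+(1-c_kc_i)\bar s_{ki}\big)$. * Type $B_n$: $[y_j,x_i]=u\big((1+c_jc_i)s_{ij}-(1-c_jc_i)\bar s_{ij}\big)$ and $[y_i,x_i]=-u\sum_{k\ne i}\big((1+c_kc_i)s_{ki}+(1-c_kc_i)\bar s_{ki}\big)-\sqrt2\,v\,\tau_i$.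 Then the natural algebra homomorphisms from $F[\mathfrak h^*]=F[x_1,\dots,x_n]$, $\mathcal C_n$, $FW$ and $F[\mathfrak h]=F[y_1,\dots,y_n]$ to $H_W$ are injective, so these are subalgebras of $H_W$, and multiplication induces an isomorphism of vector spaces $$F[\mathfrak h^*]\otimes\mathcal C_n\otimes FW\otimes F[\mathfrak h]\xrightarrow{\ \simeq\ }H_W .$$ Equivalently, the elements $x^\alpha c^\epsilon w y^\gamma$ with $\alpha,\gamma\in\mathbb Z_{\ge0}^n$, $\epsilon\in(\mathbb Z/2)^n$, $w\in W$ form a basis of $H_W$ over $F$ (the PBW basis). Here $x^\alpha=\prod_i x_i^{\alpha_i}$, $y^\gamma=\prod_i y_i^{\gamma_i}$, and $c^\epsilon=c_1^{\epsilon_1}\cdots c_n^{\epsilon_n}$ in this order. -/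

import Mathlib

open scoped TensorProduct

noncomputable section

namespace DaHCa

/-! ### Classical Weyl groups as groups of signed permutations -/

/-- The three classical families: `A` stands for `W_{A_{n-1}} = S_n`, `D` for `W_{D_n}`,
`B` for `W_{B_n}`. In all three cases the parameter `n` is the dimension of `𝔥 = Fⁿ`. -/
inductive WeylType
  | A
  | D
  | B

/-- Signed permutations of `1, …, n`, written as `w = ε σ` with signs `ε` and a permutation `σ`. The
product is `(ε σ) (ε' σ') = (ε · (ε' ∘ σ⁻¹)) (σ σ')`. -/
abbrev SignedPerm (n : ℕ) : Type :=
  (Fin n → ℤˣ) ⋊[mulAutArrow (G := Equiv.Perm (Fin n)) (A := Fin n) (M := ℤˣ)] Equiv.Perm (Fin n)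

/-- The index `w · i` obtained by forgetting the sign: `w e_i = ± e_{w · i}`. -/
def SignedPerm.idx {n : ℕ} (w : SignedPerm n) (i : Fin n) : Fin n := w.right i

/-- The sign in `w e_i = ± e_{w · i}`. -/
def SignedPerm.sgn {n : ℕ} (w : SignedPerm n) (i : Fin n) : ℤˣ := w.left (w.right i)

theorem SignedPerm.mul_left_apply {n : ℕ} (w z : SignedPerm n) (i : Fin n) :
    (w * z).left i = w.left i * z.left (w.right⁻¹ i) := rfl

theorem SignedPerm.idx_mul {n : ℕ} (w z : SignedPerm n) (i : Fin n) :
    (w * z).idx i = w.idx (z.idx i) := rfl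

theorem SignedPerm.sgn_mul {n : ℕ} (w z : SignedPerm n) (i : Fin n) :
    (w * z).sgn i = w.sgn (z.idx i) * z.sgn i := by
  change w.left (w.right (z.right i)) * z.left (w.right⁻¹ (w.right (z.right i))) = _
  have h : w.right⁻¹ (w.right (z.right i)) = z.right i := w.right.symm_apply_apply _
  rw [h]
  rfl

/-- The homomorphism sending a signed permutation to the product of its signs. -/
def signProd (n : ℕ) : SignedPerm n →* ℤˣ where
  toFun w := ∏ i, w.left i
  map_one' := by simp
  map_mul' w z := by
    simp only [SignedPerm.mul_left_apply, Finset.prod_mul_distrib]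
    congr 1
    exact Equiv.prod_comp (w.right⁻¹ : Equiv.Perm (Fin n)) z.left

/-- The Weyl group inside the signed permutations: all signs trivial in type `A_{n-1}`, an even
number of sign changes in type `D_n`, everything in type `B_n`. -/
def weylGroup (T : WeylType) (n : ℕ) : Subgroup (SignedPerm n) :=
  match T with
  | .A => (SemidirectProduct.inr : Equiv.Perm (Fin n) →* SignedPerm n).range
  | .D => (signProd n).ker
  | .B => ⊤

/-- The transposition `s_{ij}` of `i` and `j`. -/
def transp {n : ℕ} (i j : Fin n) : SignedPerm n := ⟨1, Equiv.swap i j⟩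

/-- The transposition of `i` and `j` coupled with the sign changes at `i` and `j`. -/
def transpBar {n : ℕ} (i j : Fin n) : SignedPerm n :=
  ⟨Pi.mulSingle i (-1) * Pi.mulSingle j (-1), Equiv.swap i j⟩

/-- The sign change at `i`. -/
def signChange {n : ℕ} (i : Fin n) : SignedPerm n := ⟨Pi.mulSingle i (-1), 1⟩

theorem transp_mem (T : WeylType) {n : ℕ} (i j : Fin n) : transp i j ∈ weylGroup T n := by
  cases T
  · exact ⟨Equiv.swap i j, rfl⟩
  · change ∏ k, (1 : Fin n → ℤˣ) k = 1
    simp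
  · trivial

theorem transpBar_mem_D {n : ℕ} (i j : Fin n) : transpBar i j ∈ weylGroup .D n := by
  change ∏ k, (Pi.mulSingle i (-1) * Pi.mulSingle j (-1) : Fin n → ℤˣ) k = 1
  simp [Finset.prod_mul_distrib]

/-- `s_{ij}` as an element of the Weyl group. -/
def s (T : WeylType) {n : ℕ} (i j : Fin n) : weylGroup T n := ⟨transp i j, transp_mem T i j⟩

/-- `s̄_{ij}` as an element of the Weyl group of type `D_n`. -/
def sBarD {n : ℕ} (i j : Fin n) : weylGroup .D n := ⟨transpBar i j, transpBar_mem_D i j⟩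

/-- `s̄_{ij}` as an element of the Weyl group of type `B_n`. -/
def sBarB {n : ℕ} (i j : Fin n) : weylGroup .B n := ⟨transpBar i j, trivial⟩

/-- `τ_i` as an element of the Weyl group of type `B_n`. -/
def tauB {n : ℕ} (i : Fin n) : weylGroup .B n := ⟨signChange i, trivial⟩

/-! ### The rational double affine Hecke–Clifford algebra -/

/-- The generators `x_i`, `y_i`, `c_i` (`1 ≤ i ≤ n`) and `w ∈ W`. -/
inductive Gen (T : WeylType) (n : ℕ)
  | x (i : Fin n)
  | y (i : Fin n)
  | c (i : Fin n)
  | w (w : weylGroup T n)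

section Relations

variable (F : Type*) [Field F] (T : WeylType) (n : ℕ)

/-- The free algebra on the generators. -/
abbrev Free : Type _ := FreeAlgebra F (Gen T n)

variable {T n}

/-- The generator `x_i` of the free algebra. -/
def fx (i : Fin n) : Free F T n := FreeAlgebra.ι F (Gen.x i)

/-- The generator `y_i` of the free algebra. -/
def fy (i : Fin n) : Free F T n := FreeAlgebra.ι F (Gen.y i)

/-- The generator `c_i` of the free algebra. -/
def fc (i : Fin n) : Free F T n := FreeAlgebra.ι F (Gen.c i)

/-- The generator `w` of the free algebra. -/
def fw (w : weylGroup T n) : Free F T n := FreeAlgebra.ι F (Gen.w w)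

variable {F}

/-- The prescribed value of `[y_j, x_i]` for `i ≠ j`. -/
def offDiag (T : WeylType) {n : ℕ} (u : F) (j i : Fin n) : Free F T n :=
  match T with
  | .A => u • ((1 + fc F j * fc F i) * fw F (s .A j i))
  | .D => u • ((1 + fc F j * fc F i) * fw F (s .D i j) -
      (1 - fc F j * fc F i) * fw F (sBarD i j))
  | .B => u • ((1 + fc F j * fc F i) * fw F (s .B i j) -
      (1 - fc F j * fc F i) * fw F (sBarB i j))

/-- The prescribed value of `[y_i, x_i]`. -/
def diag [Algebra ℂ F] (T : WeylType) {n : ℕ} (u v : F) (i : Fin n) : Free F T n :=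
  match T with
  | .A => -(u • ∑ k ∈ Finset.univ.erase i, (1 + fc F k * fc F i) * fw F (s .A k i))
  | .D => -(u • ∑ k ∈ Finset.univ.erase i,
      ((1 + fc F k * fc F i) * fw F (s .D k i) + (1 - fc F k * fc F i) * fw F (sBarD k i)))
  | .B => -(u • ∑ k ∈ Finset.univ.erase i,
      ((1 + fc F k * fc F i) * fw F (s .B k i) + (1 - fc F k * fc F i) * fw F (sBarB k i))) -
      (algebraMap ℂ F (Real.sqrt 2 : ℂ) * v) • fw F (tauB i)

/-- The defining relations of the rational double affine Hecke–Clifford algebra. -/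
inductive Rel [Algebra ℂ F] (T : WeylType) (n : ℕ) (u v : F) : Free F T n → Free F T n → Prop
  /- the generators `w` multiply as in the group `W` -/
  | w_one : Rel T n u v (fw F 1) 1
  | w_mul (w z : weylGroup T n) : Rel T n u v (fw F (w * z)) (fw F w * fw F z)
  /- the Clifford relations -/
  | c_sq (i : Fin n) : Rel T n u v (fc F i * fc F i) 1
  | c_anti (i j : Fin n) (h : i ≠ j) : Rel T n u v (fc F i * fc F j) (-(fc F j * fc F i))
  /- commutation of the `x`, `y`, `c` -/
  | xx (i j : Fin n) : Rel T n u v (fx F i * fx F j) (fx F j * fx F i)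
  | yy (i j : Fin n) : Rel T n u v (fy F i * fy F j) (fy F j * fy F i)
  | yc (i j : Fin n) : Rel T n u v (fy F i * fc F j) (fc F j * fy F i)
  | xc_same (i : Fin n) : Rel T n u v (fx F i * fc F i) (-(fc F i * fx F i))
  | xc (i j : Fin n) (h : i ≠ j) : Rel T n u v (fx F i * fc F j) (fc F j * fx F i)
  /- conjugation by `w ∈ W` is the action of `w` on `𝔥*`, `𝔥` and the Clifford algebra -/
  | conj_x (w : weylGroup T n) (i : Fin n) : Rel T n u v (fw F w * fx F i * fw F w⁻¹)
      (((w.1.sgn i : ℤ) : F) • fx F (w.1.idx i))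
  | conj_y (w : weylGroup T n) (i : Fin n) : Rel T n u v (fw F w * fy F i * fw F w⁻¹)
      (((w.1.sgn i : ℤ) : F) • fy F (w.1.idx i))
  | conj_c (w : weylGroup T n) (i : Fin n) : Rel T n u v (fw F w * fc F i * fw F w⁻¹)
      (((w.1.sgn i : ℤ) : F) • fc F (w.1.idx i))
  /- the commutators `[y_j, x_i]` -/
  | yx_ne (i j : Fin n) (h : i ≠ j) :
      Rel T n u v (fy F j * fx F i - fx F i * fy F j) (offDiag T u j i)
  | yx_eq (i : Fin n) : Rel T n u v (fy F i * fx F i - fx F i * fy F i) (diag T u v i)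

end Relations

section TheAlgebra

variable {F : Type*} [Field F] [Algebra ℂ F]

/-- The rational double affine Hecke–Clifford algebra of type `T` with parameters `u`, `v`.
The parameter `v` only enters in type `B`. -/
abbrev Alg (T : WeylType) (n : ℕ) (u v : F) : Type _ := RingQuot (Rel T n u v)

variable (T : WeylType) {n : ℕ} (u v : F)

/-- The generator `x_i`. -/
def x (i : Fin n) : Alg T n u v := RingQuot.mkAlgHom F (Rel T n u v) (fx F i)

/-- The generator `y_i`. -/
def y (i : Fin n) : Alg T n u v := RingQuot.mkAlgHom F (Rel T n u v) (fy F i)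

/-- The generator `c_i`. -/
def c (i : Fin n) : Alg T n u v := RingQuot.mkAlgHom F (Rel T n u v) (fc F i)

/-- The generator attached to `w ∈ W`. -/
def g (w : weylGroup T n) : Alg T n u v := RingQuot.mkAlgHom F (Rel T n u v) (fw F w)

theorem x_comm (i j : Fin n) : x T u v i * x T u v j = x T u v j * x T u v i := by
  simpa only [x, map_mul] using RingQuot.mkAlgHom_rel F (Rel.xx (T := T) (u := u) (v := v) i j)

theorem y_comm (i j : Fin n) : y T u v i * y T u v j = y T u v j * y T u v i := by
  simpa only [y, map_mul] using RingQuot.mkAlgHom_rel F (Rel.yy (T := T) (u := u) (v := v) i j)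

theorem c_sq (i : Fin n) : c T u v i * c T u v i = 1 := by
  simpa only [c, map_mul, map_one] using
    RingQuot.mkAlgHom_rel F (Rel.c_sq (T := T) (u := u) (v := v) i)

theorem c_anti (i j : Fin n) (h : i ≠ j) : c T u v i * c T u v j = -(c T u v j * c T u v i) := by
  simpa only [c, map_mul, map_neg] using
    RingQuot.mkAlgHom_rel F (Rel.c_anti (T := T) (u := u) (v := v) i j h)

theorem g_one : g T u v (1 : weylGroup T n) = 1 := by
  simpa only [g, map_one] using RingQuot.mkAlgHom_rel F (Rel.w_one (T := T) (n := n) (u := u) (v := v))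

theorem g_mul (w z : weylGroup T n) : g T u v (w * z) = g T u v w * g T u v z := by
  simpa only [g, map_mul] using RingQuot.mkAlgHom_rel F (Rel.w_mul (T := T) (u := u) (v := v) w z)

end TheAlgebra

/-! ### The four subalgebras and the multiplication map -/

section Polynomials

variable {F A : Type*} [Field F] [Ring A] [Algebra F A] {n : ℕ}

/-- The algebra homomorphism from the polynomial ring to a (noncommutative) algebra that sends the
variables to given commuting elements. -/
def polyHom (a : Fin n → A) (h : ∀ i j, a i * a j = a j * a i) :
    MvPolynomial (Fin n) F →ₐ[F] A :=
  letI : CommRing (Algebra.adjoin F (Set.range a)) :=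
    { (Algebra.adjoin F (Set.range a)).toRing with
      mul_comm := (Algebra.isMulCommutative_adjoin F
        (by rintro _ ⟨i, rfl⟩ _ ⟨j, rfl⟩; exact h i j)).is_comm.comm }
  (Algebra.adjoin F (Set.range a)).val.comp
    (MvPolynomial.aeval fun i => ⟨a i, Algebra.subset_adjoin ⟨i, rfl⟩⟩)

theorem polyHom_X (a : Fin n → A) (h : ∀ i j, a i * a j = a j * a i) (i : Fin n) :
    polyHom (F := F) a h (MvPolynomial.X i) = a i := by
  simp [polyHom]

end Polynomials

/-- The standard quadratic form `∑ᵢ vᵢ²` on `Fⁿ`. -/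
def stdForm (F : Type*) [Field F] (n : ℕ) : QuadraticForm F (Fin n → F) :=
  QuadraticMap.weightedSumSquares F (fun _ : Fin n => (1 : F))

/-- The Clifford algebra `𝒞_n`: the standard basis vectors become generators with square `1` that
anticommute pairwise. -/
abbrev Cl (F : Type*) [Field F] (n : ℕ) : Type _ := CliffordAlgebra (stdForm F n)

theorem clifford_sq {F A : Type*} [Field F] [Algebra ℂ F] [Ring A] [Algebra F A] {n : ℕ}
    (a : Fin n → A) (h1 : ∀ i, a i * a i = 1) (h2 : ∀ i j, i ≠ j → a i * a j = -(a j * a i))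
    (m : Fin n → F) :
    Fintype.linearCombination F a m * Fintype.linearCombination F a m =
      algebraMap F A (stdForm F n m) := by
  have two : (2 : F) ≠ 0 := by
    intro h
    refine two_ne_zero (α := ℂ) ((algebraMap ℂ F).injective ?_)
    rw [map_ofNat, map_zero, h]
  have key : ∀ i j, (m i * m j) • (a i * a j) + (m j * m i) • (a j * a i) =
      if i = j then (2 : F) • ((m i * m i) • (1 : A)) else 0 := by
    intro i j
    split_ifs with hij
    · subst hij
      rw [h1, two_smul]
    · rw [h2 i j hij, mul_comm (m j)]
      simp
  have e1 : Fintype.linearCombination F a m * Fintype.linearCombination F a m =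
      ∑ i, ∑ j, (m i * m j) • (a i * a j) := by
    simp only [Fintype.linearCombination_apply, Finset.sum_mul_sum, smul_mul_smul_comm]
  have e2 : Fintype.linearCombination F a m * Fintype.linearCombination F a m =
      ∑ i, ∑ j, (m j * m i) • (a j * a i) := by
    rw [e1, Finset.sum_comm]
  have e3 : (2 : F) • (Fintype.linearCombination F a m * Fintype.linearCombination F a m) =
      (2 : F) • algebraMap F A (stdForm F n m) := by
    rw [two_smul]
    nth_rewrite 1 [e1]
    rw [e2]
    simp only [← Finset.sum_add_distrib, key, Finset.sum_ite_eq, Finset.mem_univ, if_true]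
    rw [← Finset.smul_sum, ← Finset.sum_smul, Algebra.algebraMap_eq_smul_one]
    simp [stdForm, QuadraticMap.weightedSumSquares_apply]
  have := congrArg (fun t => (2 : F)⁻¹ • t) e3
  simpa [smul_smul, two] using this

section Maps

variable {F : Type*} [Field F] [Algebra ℂ F] (T : WeylType) (n : ℕ) (u v : F)

/-- `F[𝔥*] = F[x_1, …, x_n] → H`, `x_i ↦ x_i`. -/
def xHom : MvPolynomial (Fin n) F →ₐ[F] Alg T n u v := polyHom (x T u v) (x_comm T u v)

/-- `F[𝔥] = F[y_1, …, y_n] → H`, `y_i ↦ y_i`. -/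
def yHom : MvPolynomial (Fin n) F →ₐ[F] Alg T n u v := polyHom (y T u v) (y_comm T u v)

/-- `𝒞_n → H`, `c_i ↦ c_i`. -/
def cHom : Cl F n →ₐ[F] Alg T n u v :=
  CliffordAlgebra.lift (stdForm F n) ⟨Fintype.linearCombination F (c T u v),
    clifford_sq (c T u v) (c_sq T u v) (c_anti T u v)⟩

/-- The group algebra `F W → H`, `w ↦ w`. -/
def wHom : MonoidAlgebra F (weylGroup T n) →ₐ[F] Alg T n u v :=
  MonoidAlgebra.lift F (Alg T n u v) (weylGroup T n)
    { toFun := g T u v, map_one' := g_one T u v, map_mul' := g_mul T u v }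

theorem xHom_X (i : Fin n) : xHom T n u v (MvPolynomial.X i) = x T u v i := polyHom_X _ _ i

theorem yHom_X (i : Fin n) : yHom T n u v (MvPolynomial.X i) = y T u v i := polyHom_X _ _ i

theorem cHom_ι (i : Fin n) :
    cHom T n u v (CliffordAlgebra.ι (stdForm F n) (Pi.single i 1)) = c T u v i := by
  simp [cHom]

theorem wHom_of (w : weylGroup T n) :
    wHom T n u v (MonoidAlgebra.of F (weylGroup T n) w) = g T u v w := by
  simp [wHom]

/-- The multiplication map `F[𝔥*] ⊗ 𝒞_n ⊗ F W ⊗ F[𝔥] → H`, `p ⊗ a ⊗ b ⊗ q ↦ p a b q`. -/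
def mulMap :
    ((MvPolynomial (Fin n) F ⊗[F] Cl F n) ⊗[F] MonoidAlgebra F (weylGroup T n)) ⊗[F]
      MvPolynomial (Fin n) F →ₗ[F] Alg T n u v :=
  LinearMap.mul' F (Alg T n u v) ∘ₗ
    TensorProduct.map
      (LinearMap.mul' F (Alg T n u v) ∘ₗ
        TensorProduct.map
          (LinearMap.mul' F (Alg T n u v) ∘ₗ
            TensorProduct.map (xHom T n u v).toLinearMap (cHom T n u v).toLinearMap)
          (wHom T n u v).toLinearMap)
      (yHom T n u v).toLinearMap

theorem mulMap_tmul (p q : MvPolynomial (Fin n) F) (a : Cl F n)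
    (b : MonoidAlgebra F (weylGroup T n)) :
    mulMap T n u v (((p ⊗ₜ a) ⊗ₜ b) ⊗ₜ q) =
      xHom T n u v p * cHom T n u v a * wHom T n u v b * yHom T n u v q := rfl

/-- The element `x^α c^ε w y^γ`, where `c^ε = c_1^{ε_1} ⋯ c_n^{ε_n}` is the product in increasing
order of the indices (and likewise for `x^α` and `y^γ`, where the order is irrelevant). -/
def pbw (t : (Fin n → ℕ) × (Fin n → ZMod 2) × weylGroup T n × (Fin n → ℕ)) : Alg T n u v :=
  (List.ofFn fun i => x T u v i ^ t.1 i).prod *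
    (List.ofFn fun i => c T u v i ^ (t.2.1 i).val).prod *
    g T u v t.2.2.1 *
    (List.ofFn fun i => y T u v i ^ t.2.2.2 i).prod

end Maps

end DaHCa

end

/-! Spanning is straightening: every relation moves an `x` to the left or a `y` to the right, modulo
products with fewer `x`. Linear independence is the real content. It is proved by constructing a
module in which the ordered monomials, applied to one vector, give visibly independent elements.

Call the algebra on the `c_i`, `W` and the `y_i`, without the `x_i`, the lower algebra. For a module
`M` over it, an action of all of `H_W` is put on `F[𝔥*] ⊗ M`, as induction from the lower algebra
would do if PBW were known. The `x_i` act by multiplication, the `c_j` and `w` act on `1 ⊗ M` as on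
`M` and move past the `x_i` by their relations, and `y_j` is forced by `y_j x_i = x_i y_j + κ_{ji}`,
where `κ_{ji}` (`kern`) is the prescribed commutator. The recursion for `y_j` is consistent, and the
remaining relations survive each multiplication by some `x_k`, because of four identities for `κ`: -
`kern_comm_x`, the Jacobi identity for `y_j, x_i, x_k`: `[κ_{ji}, x_k] = [κ_{jk}, x_i]`. It makes
the action of `y_j` well defined (`shearX_comm`). - `kern_comm_y`, the Jacobi identity for `x_i,
y_j, y_k`. It makes the `y_j` commute (`indY_comm`). - `kern_mul_c_ne` and `kern_mul_c_same`:
`κ_{ji}` has the same signs as `x_i` when it passes the `c_k`. - `mul_kern`: `w κ_{ji} w⁻¹` is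
`κ_{w·j, w·i}` times the signs of `w` at `j` and `i`.

The three types are treated at once: `s̄_{ij}` is replaced by `0` in type `A`, `τ_i` by `0` in types
`A` and `D`, and the coefficient `√2 v` is a single parameter in the abstract identities.

For `M` one takes functions `W → 𝒞_n ⊗ F[𝔥]`, a model of `FW ⊗ 𝒞_n ⊗ F[𝔥]`. On the vector `1 ⊗ δ_1`
the product `p a w q` gives `p ⊗ δ_w (w⁻¹(a) ⊗ q)` (`rep_mulMap`), with no commutator entering.
Independence then follows from that of the monomials `c^ε` in `𝒞_n`, itself proved with a spin
module. -/

noncomputable section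

namespace DaHCa

/-! ### The commutator kernel in an abstract algebra -/

section Kernel

variable {F A : Type*} [Field F] [Ring A] [Algebra F A] {n : ℕ}

/-- A family of pairwise anticommuting square roots of `1`. -/
structure IsCliffordFamily (C : Fin n → A) : Prop where
  sq : ∀ i, C i * C i = 1
  anti : ∀ i j, i ≠ j → C i * C j = -(C j * C i)

/-- The commutation of the `x_i` with the Clifford generators. -/
structure AnticommutesDiagonally (X C : Fin n → A) : Prop where
  same : ∀ i, X i * C i = -(C i * X i)
  ne : ∀ i j, i ≠ j → X i * C j = C j * X i

/-- Families `S`, `Sb`, `τ` that move the family `Z` as `s_{ij}`, `s̄_{ij}`, `τ_i` do. -/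
structure Reflects (S Sb : Fin n → Fin n → A) (τ Z : Fin n → A) : Prop where
  s_left : ∀ i j, S i j * Z i = Z j * S i j
  s_right : ∀ i j, S i j * Z j = Z i * S i j
  s_ne : ∀ i j k, k ≠ i → k ≠ j → S i j * Z k = Z k * S i j
  sb_left : ∀ i j, i ≠ j → Sb i j * Z i = -(Z j * Sb i j)
  sb_right : ∀ i j, i ≠ j → Sb i j * Z j = -(Z i * Sb i j)
  sb_ne : ∀ i j k, k ≠ i → k ≠ j → Sb i j * Z k = Z k * Sb i j
  tau_same : ∀ i, τ i * Z i = -(Z i * τ i)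
  tau_ne : ∀ i j, j ≠ i → τ i * Z j = Z j * τ i

/-- The element `(1 + c_j c_i) s_{ji}`. -/
def eps (C : Fin n → A) (S : Fin n → Fin n → A) (j i : Fin n) : A := (1 + C j * C i) * S j i

/-- The element `(1 - c_j c_i) s̄_{ji}`. -/
def epsBar (C : Fin n → A) (Sb : Fin n → Fin n → A) (j i : Fin n) : A :=
  (1 - C j * C i) * Sb j i

/-- The value of the commutator `[y_j, x_i]`. -/
def kern (u v : F) (C : Fin n → A) (S Sb : Fin n → Fin n → A) (τ : Fin n → A)
    (j i : Fin n) : A :=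
  if j = i then
    -(u • ∑ k ∈ Finset.univ.erase i, (eps C S k i + epsBar C Sb k i)) - v • τ i
  else u • (eps C S j i - epsBar C Sb j i)

theorem kern_self (u v : F) (C : Fin n → A) (S Sb : Fin n → Fin n → A) (τ : Fin n → A)
    (i : Fin n) : kern u v C S Sb τ i i =
      -(u • ∑ k ∈ Finset.univ.erase i, (eps C S k i + epsBar C Sb k i)) - v • τ i := if_pos rfl

theorem kern_ne (u v : F) (C : Fin n → A) (S Sb : Fin n → Fin n → A) (τ : Fin n → A)
    {j i : Fin n} (h : j ≠ i) : kern u v C S Sb τ j i = u • (eps C S j i - epsBar C Sb j i) :=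
  if_neg h

variable {C X Y : Fin n → A} {S Sb : Fin n → Fin n → A} {τ : Fin n → A}

/-! ### The commutator kernel and the `x_i` -/

section EpsX

theorem AnticommutesDiagonally.mul_ne (hX : AnticommutesDiagonally X C) {i j k : Fin n}
    (h1 : k ≠ i) (h2 : k ≠ j) : C i * C j * X k = X k * (C i * C j) := by
  rw [mul_assoc, ← hX.ne k j h2, ← mul_assoc, ← hX.ne k i h1, mul_assoc]

theorem AnticommutesDiagonally.mul_right (hX : AnticommutesDiagonally X C) {i j : Fin n}
    (h : i ≠ j) : C i * C j * X j = -(X j * (C i * C j)) := by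
  have h1 : C j * X j = -(X j * C j) := by rw [hX.same, neg_neg]
  rw [mul_assoc, h1, mul_neg, ← mul_assoc, ← hX.ne j i h.symm, mul_assoc]

theorem eps_mul_x_ne (hX : AnticommutesDiagonally X C) (hS : Reflects S Sb τ X) {j i k : Fin n}
    (h1 : k ≠ j) (h2 : k ≠ i) : eps C S j i * X k = X k * eps C S j i := by
  rw [eps, mul_assoc, hS.s_ne j i k h1 h2, ← mul_assoc, add_mul, hX.mul_ne h1 h2]
  noncomm_ring

theorem epsBar_mul_x_ne (hX : AnticommutesDiagonally X C) (hS : Reflects S Sb τ X)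
    {j i k : Fin n} (h1 : k ≠ j) (h2 : k ≠ i) : epsBar C Sb j i * X k = X k * epsBar C Sb j i := by
  rw [epsBar, mul_assoc, hS.sb_ne j i k h1 h2, ← mul_assoc, sub_mul, hX.mul_ne h1 h2]
  noncomm_ring

/-- Write `ε_{kj}` for `eps C S k j`. The transposition turns `x_k` into `x_j`, and `c_k c_j`
anticommutes with `x_j`; hence `ε_{kj} x_k = x_j ε_{jk}`. The same with `j` and `k` exchanged makes
the two commutators opposite. -/
theorem eps_comm_x (hC : IsCliffordFamily C) (hX : AnticommutesDiagonally X C)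
    (hS : Reflects S Sb τ X) (hSs : ∀ i j, S i j = S j i) {j k : Fin n} (h : k ≠ j) :
    eps C S k j * X k - X k * eps C S k j = -(eps C S j k * X j - X j * eps C S j k) := by
  have e1 : eps C S k j * X k = X j * (1 - C k * C j) * S k j := by
    rw [eps, mul_assoc, hS.s_left, ← mul_assoc, add_mul, hX.mul_right h]
    noncomm_ring
  have e2 : eps C S j k * X j = X k * (1 + C k * C j) * S k j := by
    rw [eps, mul_assoc, hS.s_left, ← mul_assoc, add_mul, hX.mul_right h.symm, hSs j k,
      hC.anti j k h.symm]
    noncomm_ring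
  rw [e1, e2, eps, eps, hSs j k, hC.anti j k h.symm]
  noncomm_ring

/-- As for `eps`, but `s̄` sends `x_k` to `-x_j`, so that `ε̄_{kj} x_k = -x_j ε̄_{jk}`. The extra
sign makes the two commutators equal instead of opposite, which matches the minus sign between the
two parts of the off-diagonal kernel. -/
theorem epsBar_comm_x (hC : IsCliffordFamily C) (hX : AnticommutesDiagonally X C)
    (hS : Reflects S Sb τ X) (hSs : ∀ i j, Sb i j = Sb j i) {j k : Fin n} (h : k ≠ j) :
    epsBar C Sb k j * X k - X k * epsBar C Sb k j =
      epsBar C Sb j k * X j - X j * epsBar C Sb j k := by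
  have e1 : epsBar C Sb k j * X k = -(X j * (1 + C k * C j) * Sb k j) := by
    rw [epsBar, mul_assoc, hS.sb_left _ _ h, mul_neg, ← mul_assoc, sub_mul, hX.mul_right h]
    noncomm_ring
  have e2 : epsBar C Sb j k * X j = -(X k * (1 - C k * C j) * Sb k j) := by
    rw [epsBar, mul_assoc, hS.sb_left _ _ h.symm, mul_neg, ← mul_assoc, sub_mul,
      hX.mul_right h.symm, hSs j k, hC.anti j k h.symm]
    noncomm_ring
  rw [e1, e2, epsBar, epsBar, hSs j k, hC.anti j k h.symm]
  noncomm_ring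

theorem tau_comm_ne (hS : Reflects S Sb τ X) {j k : Fin n} (h : k ≠ j) :
    τ j * X k - X k * τ j = 0 := by
  rw [hS.tau_ne j k h, sub_self]

/-- The commutator with `a` of the diagonal kernel reduces to one summand when `a` commutes with
the other ones. -/
theorem kern_self_comm (u v : F) {i j : Fin n} (h : j ≠ i) (a : A)
    (h1 : ∀ k, k ≠ i → k ≠ j → eps C S k i * a = a * eps C S k i)
    (h2 : ∀ k, k ≠ i → k ≠ j → epsBar C Sb k i * a = a * epsBar C Sb k i)
    (h3 : τ i * a - a * τ i = 0) :
    kern u v C S Sb τ i i * a - a * kern u v C S Sb τ i i =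
      -(u • ((eps C S j i * a - a * eps C S j i) +
        (epsBar C Sb j i * a - a * epsBar C Sb j i))) := by
  have key : (∑ k ∈ Finset.univ.erase i, (eps C S k i + epsBar C Sb k i)) * a -
      a * (∑ k ∈ Finset.univ.erase i, (eps C S k i + epsBar C Sb k i)) =
      (eps C S j i * a - a * eps C S j i) + (epsBar C Sb j i * a - a * epsBar C Sb j i) := by
    rw [Finset.sum_mul, Finset.mul_sum, ← Finset.sum_sub_distrib,
      Finset.sum_eq_single_of_mem j (Finset.mem_erase.2 ⟨h, Finset.mem_univ j⟩)]
    · noncomm_ring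
    · intro k hk hkj
      have hki := (Finset.mem_erase.1 hk).1
      rw [add_mul, mul_add, h1 k hki hkj, h2 k hki hkj, sub_self]
  rw [← key, kern_self]
  have h4 : (v • τ i) * a - a * (v • τ i) = 0 := by
    rw [smul_mul_assoc, mul_smul_comm, ← smul_sub, h3, smul_zero]
  simp only [sub_mul, mul_sub, neg_mul, mul_neg, smul_mul_assoc, mul_smul_comm, smul_sub] at h4 ⊢
  rw [sub_eq_zero.1 h4]
  abel

/-- This is the Jacobi identity for `y_j, x_i, x_k` with commuting `x`, stated without any `y`. For
three distinct indices both sides vanish. If `j` equals one of `i, k`, one summand of the diagonal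
kernel fails to commute, and it matches the off-diagonal kernel. -/
theorem kern_comm_x (hC : IsCliffordFamily C) (hX : AnticommutesDiagonally X C)
    (hS : Reflects S Sb τ X) (hs : ∀ i j, S i j = S j i) (hsb : ∀ i j, Sb i j = Sb j i)
    (u v : F) (j i k : Fin n) :
    kern u v C S Sb τ j i * X k - X k * kern u v C S Sb τ j i =
      kern u v C S Sb τ j k * X i - X i * kern u v C S Sb τ j k := by
  have main : ∀ j k : Fin n, j ≠ k →
      kern u v C S Sb τ j j * X k - X k * kern u v C S Sb τ j j =
        kern u v C S Sb τ j k * X j - X j * kern u v C S Sb τ j k := by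
    intro j k h
    rw [kern_self_comm u v h.symm (X k)
      (fun l _ h2 => eps_mul_x_ne hX hS h2.symm h.symm)
      (fun l _ h2 => epsBar_mul_x_ne hX hS h2.symm h.symm) (tau_comm_ne hS h.symm),
      eps_comm_x hC hX hS hs h.symm, epsBar_comm_x hC hX hS hsb h.symm, kern_ne _ _ _ _ _ _ h]
    simp only [smul_mul_assoc, mul_smul_comm, ← smul_sub, ← smul_neg]
    congr 1
    noncomm_ring
  rcases eq_or_ne i k with rfl | hik
  · rfl
  rcases eq_or_ne j i with rfl | hji
  · exact main j k hik
  rcases eq_or_ne j k with rfl | hjk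
  · exact (main j i hji).symm
  rw [kern_ne _ _ _ _ _ _ hji, kern_ne _ _ _ _ _ _ hjk]
  simp only [smul_mul_assoc, mul_smul_comm, sub_mul, mul_sub,
    eps_mul_x_ne hX hS hjk.symm hik.symm, epsBar_mul_x_ne hX hS hjk.symm hik.symm,
    eps_mul_x_ne hX hS hji.symm hik, epsBar_mul_x_ne hX hS hji.symm hik, sub_self]

end EpsX

/-! ### The commutator kernel and the Clifford generators -/

section EpsC

theorem IsCliffordFamily.mul_ne (hC : IsCliffordFamily C) {i j k : Fin n}
    (h1 : k ≠ i) (h2 : k ≠ j) : C i * C j * C k = C k * (C i * C j) := by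
  rw [mul_assoc, hC.anti j k h2.symm, mul_neg, ← mul_assoc, hC.anti i k h1.symm]
  noncomm_ring

theorem eps_mul_c_ne (hC : IsCliffordFamily C) (hS : Reflects S Sb τ C) {j i k : Fin n}
    (h1 : k ≠ j) (h2 : k ≠ i) : eps C S j i * C k = C k * eps C S j i := by
  rw [eps, mul_assoc, hS.s_ne j i k h1 h2, ← mul_assoc, add_mul, hC.mul_ne h1 h2]
  noncomm_ring

theorem epsBar_mul_c_ne (hC : IsCliffordFamily C) (hS : Reflects S Sb τ C) {j i k : Fin n}
    (h1 : k ≠ j) (h2 : k ≠ i) : epsBar C Sb j i * C k = C k * epsBar C Sb j i := by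
  rw [epsBar, mul_assoc, hS.sb_ne j i k h1 h2, ← mul_assoc, sub_mul, hC.mul_ne h1 h2]
  noncomm_ring

/-- The transposition exchanges `c_j` and `c_i`, and `(1 + c_j c_i) c_i = c_i + c_j = c_j (1 + c_j
c_i)`. -/
theorem eps_mul_c_left (hC : IsCliffordFamily C) (hS : Reflects S Sb τ C) (j i : Fin n) :
    eps C S j i * C j = C j * eps C S j i := by
  rw [eps, mul_assoc, hS.s_left, ← mul_assoc, ← mul_assoc, add_mul, mul_add, ← mul_assoc, hC.sq,
    mul_assoc (C j), hC.sq]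
  noncomm_ring

theorem epsBar_mul_c_left (hC : IsCliffordFamily C) (hS : Reflects S Sb τ C) {j i : Fin n}
    (h : j ≠ i) : epsBar C Sb j i * C j = C j * epsBar C Sb j i := by
  rw [epsBar, mul_assoc, hS.sb_left _ _ h, mul_neg, ← mul_assoc, ← mul_assoc, sub_mul, mul_sub,
    ← mul_assoc, hC.sq, mul_assoc (C j), hC.sq]
  noncomm_ring

theorem IsCliffordFamily.mul_mul_self (hC : IsCliffordFamily C) {j i : Fin n} (h : j ≠ i) :
    C j * C i * C j = - C i := by
  rw [hC.anti j i h, neg_mul, mul_assoc, hC.sq, mul_one]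

/-- Here the Clifford factor produces a sign: `(1 + c_j c_i) c_j = c_j - c_i = -c_i (1 + c_j c_i)`.
-/
theorem eps_mul_c_right (hC : IsCliffordFamily C) (hS : Reflects S Sb τ C) {j i : Fin n}
    (h : j ≠ i) : eps C S j i * C i = -(C i * eps C S j i) := by
  rw [eps, mul_assoc, hS.s_right, ← mul_assoc, ← mul_assoc, add_mul, mul_add, ← mul_assoc,
    hC.mul_mul_self h, hC.mul_mul_self h.symm]
  noncomm_ring

theorem epsBar_mul_c_right (hC : IsCliffordFamily C) (hS : Reflects S Sb τ C) {j i : Fin n}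
    (h : j ≠ i) : epsBar C Sb j i * C i = -(C i * epsBar C Sb j i) := by
  rw [epsBar, mul_assoc, hS.sb_right _ _ h, mul_neg, ← mul_assoc, ← mul_assoc, sub_mul, mul_sub,
    ← mul_assoc, hC.mul_mul_self h, hC.mul_mul_self h.symm]
  noncomm_ring

/-- Needed because `y_j` and `x_i` both commute with `c_k` for `k ≠ i`, so their commutator must do
so too. It holds for each summand of the kernel separately. -/
theorem kern_mul_c_ne (hC : IsCliffordFamily C) (hS : Reflects S Sb τ C) (u v : F)
    {j i k : Fin n} (h : k ≠ i) :
    kern u v C S Sb τ j i * C k = C k * kern u v C S Sb τ j i := by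
  have h1 : ∀ j, j ≠ i → eps C S j i * C k = C k * eps C S j i := by
    intro j hj
    rcases eq_or_ne k j with rfl | hkj
    · exact eps_mul_c_left hC hS _ _
    · exact eps_mul_c_ne hC hS hkj h
  have h2 : ∀ j, j ≠ i → epsBar C Sb j i * C k = C k * epsBar C Sb j i := by
    intro j hj
    rcases eq_or_ne k j with rfl | hkj
    · exact epsBar_mul_c_left hC hS hj
    · exact epsBar_mul_c_ne hC hS hkj h
  rcases eq_or_ne j i with rfl | hji
  · have h3 : (∑ l ∈ Finset.univ.erase j, (eps C S l j + epsBar C Sb l j)) * C k =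
        C k * ∑ l ∈ Finset.univ.erase j, (eps C S l j + epsBar C Sb l j) := by
      rw [Finset.sum_mul, Finset.mul_sum]
      refine Finset.sum_congr rfl fun l hl => ?_
      have hlj := (Finset.mem_erase.1 hl).1
      rw [add_mul, mul_add, h1 l hlj, h2 l hlj]
    rw [kern_self, sub_mul, mul_sub, neg_mul, mul_neg, smul_mul_assoc, mul_smul_comm, h3,
      smul_mul_assoc, mul_smul_comm, hS.tau_ne j k h]
  · rw [kern_ne _ _ _ _ _ _ hji, smul_mul_assoc, mul_smul_comm, sub_mul, mul_sub, h1 j hji, h2 j hji]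

/-- Needed because `c_i` commutes with `y_j` and anticommutes with `x_i`. -/
theorem kern_mul_c_same (hC : IsCliffordFamily C) (hS : Reflects S Sb τ C) (u v : F)
    (j i : Fin n) :
    kern u v C S Sb τ j i * C i = -(C i * kern u v C S Sb τ j i) := by
  have h1 : ∀ j, j ≠ i → eps C S j i * C i = -(C i * eps C S j i) :=
    fun j hj => eps_mul_c_right hC hS hj
  have h2 : ∀ j, j ≠ i → epsBar C Sb j i * C i = -(C i * epsBar C Sb j i) :=
    fun j hj => epsBar_mul_c_right hC hS hj
  rcases eq_or_ne j i with rfl | hji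
  · have h3 : (∑ l ∈ Finset.univ.erase j, (eps C S l j + epsBar C Sb l j)) * C j =
        -(C j * ∑ l ∈ Finset.univ.erase j, (eps C S l j + epsBar C Sb l j)) := by
      rw [Finset.sum_mul, Finset.mul_sum, ← Finset.sum_neg_distrib]
      refine Finset.sum_congr rfl fun l hl => ?_
      have hlj := (Finset.mem_erase.1 hl).1
      rw [add_mul, mul_add, h1 l hlj, h2 l hlj, neg_add]
    rw [kern_self, sub_mul, mul_sub, neg_mul, mul_neg, smul_mul_assoc, mul_smul_comm, h3,
      smul_mul_assoc, mul_smul_comm, hS.tau_same, smul_neg, smul_neg]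
    abel
  · rw [kern_ne _ _ _ _ _ _ hji, smul_mul_assoc, mul_smul_comm, sub_mul, mul_sub, h1 j hji,
      h2 j hji, ← smul_neg]
    congr 1
    abel

end EpsC

/-! ### The commutator kernel and the `y_i` -/

section EpsY

theorem clifford_mul_comm_y (hY : ∀ i j, Y i * C j = C j * Y i) (i j k : Fin n) :
    C i * C j * Y k = Y k * (C i * C j) := by
  rw [mul_assoc, ← hY, ← mul_assoc, ← hY, mul_assoc]

theorem eps_mul_y_ne (hY : ∀ i j, Y i * C j = C j * Y i) (hS : Reflects S Sb τ Y) {j i k : Fin n}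
    (h1 : k ≠ j) (h2 : k ≠ i) : eps C S j i * Y k = Y k * eps C S j i := by
  rw [eps, mul_assoc, hS.s_ne j i k h1 h2, ← mul_assoc, add_mul, clifford_mul_comm_y hY]
  noncomm_ring

theorem epsBar_mul_y_ne (hY : ∀ i j, Y i * C j = C j * Y i) (hS : Reflects S Sb τ Y)
    {j i k : Fin n} (h1 : k ≠ j) (h2 : k ≠ i) : epsBar C Sb j i * Y k = Y k * epsBar C Sb j i := by
  rw [epsBar, mul_assoc, hS.sb_ne j i k h1 h2, ← mul_assoc, sub_mul, clifford_mul_comm_y hY]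
  noncomm_ring

/-- The `y` commute with the Clifford factor, so the element exchanges `y_j` and `y_i` as the
transposition does, and commutes with `y_j + y_i`. -/
theorem eps_comm_y (hY : ∀ i j, Y i * C j = C j * Y i) (hS : Reflects S Sb τ Y) (j i : Fin n) :
    eps C S j i * Y j - Y j * eps C S j i = -(eps C S j i * Y i - Y i * eps C S j i) := by
  have e1 : eps C S j i * Y j = Y i * eps C S j i := by
    rw [eps, mul_assoc, hS.s_left, ← mul_assoc, add_mul, clifford_mul_comm_y hY]
    noncomm_ring
  have e2 : eps C S j i * Y i = Y j * eps C S j i := by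
    rw [eps, mul_assoc, hS.s_right, ← mul_assoc, add_mul, clifford_mul_comm_y hY]
    noncomm_ring
  rw [e1, e2]
  abel

/-- Here `y_j` and `y_i` are exchanged with a sign, so `y_j - y_i` is what commutes. -/
theorem epsBar_comm_y (hY : ∀ i j, Y i * C j = C j * Y i) (hS : Reflects S Sb τ Y) {j i : Fin n}
    (h : j ≠ i) :
    epsBar C Sb j i * Y j - Y j * epsBar C Sb j i =
      epsBar C Sb j i * Y i - Y i * epsBar C Sb j i := by
  have e1 : epsBar C Sb j i * Y j = -(Y i * epsBar C Sb j i) := by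
    rw [epsBar, mul_assoc, hS.sb_left _ _ h, mul_neg, ← mul_assoc, sub_mul, clifford_mul_comm_y hY]
    noncomm_ring
  have e2 : epsBar C Sb j i * Y i = -(Y j * epsBar C Sb j i) := by
    rw [epsBar, mul_assoc, hS.sb_right _ _ h, mul_neg, ← mul_assoc, sub_mul, clifford_mul_comm_y hY]
    noncomm_ring
  rw [e1, e2]
  abel

/-- The Jacobi identity for `x_i, y_j, y_k` with commuting `y`. As for the `x`, only the case where
`i` is one of `j, k` is not a vanishing of both sides. Commutativity of the `Y` is not assumed, so
the identity can serve to prove it. -/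
theorem kern_comm_y (hY : ∀ i j, Y i * C j = C j * Y i) (hS : Reflects S Sb τ Y)
    (u v : F) (i j k : Fin n) :
    kern u v C S Sb τ k i * Y j - Y j * kern u v C S Sb τ k i =
      kern u v C S Sb τ j i * Y k - Y k * kern u v C S Sb τ j i := by
  have main : ∀ i j : Fin n, j ≠ i →
      kern u v C S Sb τ i i * Y j - Y j * kern u v C S Sb τ i i =
        kern u v C S Sb τ j i * Y i - Y i * kern u v C S Sb τ j i := by
    intro i j h
    rw [kern_self_comm u v h (Y j)
      (fun l _ h2 => eps_mul_y_ne hY hS h2.symm h)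
      (fun l _ h2 => epsBar_mul_y_ne hY hS h2.symm h) (tau_comm_ne hS h),
      eps_comm_y hY hS, epsBar_comm_y hY hS h, kern_ne _ _ _ _ _ _ h]
    simp only [smul_mul_assoc, mul_smul_comm, ← smul_sub, ← smul_neg]
    congr 1
    noncomm_ring
  rcases eq_or_ne j k with rfl | hjk
  · rfl
  rcases eq_or_ne k i with rfl | hki
  · exact main k j hjk
  rcases eq_or_ne j i with rfl | hji
  · exact (main j k hki).symm
  rw [kern_ne _ _ _ _ _ _ hji, kern_ne _ _ _ _ _ _ hki]
  simp only [smul_mul_assoc, mul_smul_comm, sub_mul, mul_sub,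
    eps_mul_y_ne hY hS hjk hji, epsBar_mul_y_ne hY hS hjk hji,
    eps_mul_y_ne hY hS hjk.symm hki, epsBar_mul_y_ne hY hS hjk.symm hki, sub_self]

end EpsY

end Kernel

/-! ### Reflections in the Weyl group -/

section SignedPerm

variable {n : ℕ}

theorem SignedPerm.ext_idx_sgn {w z : SignedPerm n} (h1 : ∀ i, w.idx i = z.idx i)
    (h2 : ∀ i, w.sgn i = z.sgn i) : w = z := by
  have hr : w.right = z.right := Equiv.ext h1
  refine SemidirectProduct.ext (funext fun i => ?_) hr
  have h := h2 (w.right.symm i)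
  simp only [SignedPerm.sgn] at h
  rw [← hr, Equiv.apply_symm_apply] at h
  exact h

theorem SignedPerm.idx_injective (w : SignedPerm n) : Function.Injective w.idx := w.right.injective

theorem SignedPerm.idx_one (i : Fin n) : (1 : SignedPerm n).idx i = i := rfl

theorem SignedPerm.sgn_one (i : Fin n) : (1 : SignedPerm n).sgn i = 1 := rfl

theorem idx_transp (i j k : Fin n) : (transp i j).idx k = Equiv.swap i j k := rfl

theorem sgn_transp (i j k : Fin n) : (transp i j).sgn k = 1 := rfl

theorem idx_transpBar (i j k : Fin n) : (transpBar i j).idx k = Equiv.swap i j k := rfl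

theorem sgn_transpBar {i j : Fin n} (h : i ≠ j) (k : Fin n) :
    (transpBar i j).sgn k = if k = i ∨ k = j then -1 else 1 := by
  change (Pi.mulSingle i (-1) * Pi.mulSingle j (-1) : Fin n → ℤˣ) (Equiv.swap i j k) = _
  rcases eq_or_ne k i with rfl | hi
  · simp [h.symm, h]
  rcases eq_or_ne k j with rfl | hj
  · simp [h]
  simp [Equiv.swap_apply_of_ne_of_ne hi hj, hi, hj]

theorem idx_signChange (i k : Fin n) : (signChange i).idx k = k := rfl

theorem sgn_signChange (i k : Fin n) : (signChange i).sgn k = if k = i then -1 else 1 := by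
  change (Pi.mulSingle i (-1) : Fin n → ℤˣ) k = _
  rw [Pi.mulSingle_apply]

theorem transp_comm (i j : Fin n) : transp i j = transp j i := by
  rw [transp, transp, Equiv.swap_comm]

theorem transpBar_comm (i j : Fin n) : transpBar i j = transpBar j i := by
  rw [transpBar, transpBar, Equiv.swap_comm, mul_comm]

theorem SignedPerm.idx_swap (w : SignedPerm n) (i j k : Fin n) :
    w.idx (Equiv.swap i j k) = Equiv.swap (w.idx i) (w.idx j) (w.idx k) :=
  Function.Injective.map_swap w.right.injective i j k

theorem SignedPerm.sgn_swap {w : SignedPerm n} {i j : Fin n} (h : w.sgn i = w.sgn j) (k : Fin n) :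
    w.sgn (Equiv.swap i j k) = w.sgn k := by
  rw [Equiv.swap_apply_def]
  split_ifs with h1 h2
  · rw [h1, h]
  · rw [h2, h]
  · rfl

theorem SignedPerm.sgn_swap_of_ne {w : SignedPerm n} {i j : Fin n} (h : w.sgn i ≠ w.sgn j)
    (k : Fin n) : w.sgn (Equiv.swap i j k) = (if k = i ∨ k = j then -1 else 1) * w.sgn k := by
  have h' := Int.units_ne_iff_eq_neg.1 h
  rcases eq_or_ne k i with rfl | hi
  · simp [h']
  rcases eq_or_ne k j with rfl | hj
  · simp [h']
  simp [Equiv.swap_apply_of_ne_of_ne hi hj, hi, hj]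

/-- Conjugation by `w` carries `s_{ij}` to `s` at the new indices if the signs of `w` at `i` and `j`
agree, and to `s̄` if they differ; likewise with `s` and `s̄` exchanged. This lemma and the next
three are the four cases. -/
theorem SignedPerm.mul_transp {w : SignedPerm n} {i j : Fin n} (h : w.sgn i = w.sgn j) :
    w * transp i j = transp (w.idx i) (w.idx j) * w :=
  SignedPerm.ext_idx_sgn
    (fun k => by simp only [SignedPerm.idx_mul, idx_transp, SignedPerm.idx_swap])
    (fun k => by simp only [SignedPerm.sgn_mul, idx_transp, sgn_transp, SignedPerm.sgn_swap h,
      one_mul, mul_one])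

theorem SignedPerm.mul_transp_of_ne {w : SignedPerm n} {i j : Fin n} (h : w.sgn i ≠ w.sgn j) :
    w * transp i j = transpBar (w.idx i) (w.idx j) * w :=
  SignedPerm.ext_idx_sgn
    (fun k => by simp only [SignedPerm.idx_mul, idx_transp, idx_transpBar, SignedPerm.idx_swap])
    (fun k => by
      have hij : w.idx i ≠ w.idx j := fun e => h (by rw [w.idx_injective e])
      simp only [SignedPerm.sgn_mul, idx_transp, sgn_transp, SignedPerm.sgn_swap_of_ne h,
        sgn_transpBar hij, w.idx_injective.eq_iff, mul_one])

theorem SignedPerm.mul_transpBar {w : SignedPerm n} {i j : Fin n} (hij : i ≠ j)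
    (h : w.sgn i = w.sgn j) :
    w * transpBar i j = transpBar (w.idx i) (w.idx j) * w :=
  SignedPerm.ext_idx_sgn
    (fun k => by simp only [SignedPerm.idx_mul, idx_transpBar, SignedPerm.idx_swap])
    (fun k => by
      simp only [SignedPerm.sgn_mul, idx_transpBar, SignedPerm.sgn_swap h, sgn_transpBar hij,
        sgn_transpBar (w.idx_injective.ne hij), w.idx_injective.eq_iff]
      rw [mul_comm])

theorem SignedPerm.mul_transpBar_of_ne {w : SignedPerm n} {i j : Fin n} (h : w.sgn i ≠ w.sgn j) :
    w * transpBar i j = transp (w.idx i) (w.idx j) * w :=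
  SignedPerm.ext_idx_sgn
    (fun k => by simp only [SignedPerm.idx_mul, idx_transp, idx_transpBar, SignedPerm.idx_swap])
    (fun k => by
      have hij : i ≠ j := fun e => h (by rw [e])
      simp only [SignedPerm.sgn_mul, idx_transpBar, sgn_transp, SignedPerm.sgn_swap_of_ne h,
        sgn_transpBar hij, one_mul]
      split_ifs <;> simp)

theorem SignedPerm.mul_signChange (w : SignedPerm n) (i : Fin n) :
    w * signChange i = signChange (w.idx i) * w :=
  SignedPerm.ext_idx_sgn
    (fun k => by simp only [SignedPerm.idx_mul, idx_signChange])
    (fun k => by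
      simp only [SignedPerm.sgn_mul, idx_signChange, sgn_signChange, w.idx_injective.eq_iff]
      rw [mul_comm])

theorem sgn_of_mem_A {w : SignedPerm n} (h : w ∈ weylGroup .A n) (i : Fin n) : w.sgn i = 1 := by
  obtain ⟨σ, rfl⟩ := h
  rfl

end SignedPerm

/-! ### Equivariance of the commutator kernel under `W` -/

section Equivariance

variable {F A : Type*} [Field F] [Ring A] [Algebra F A] {T : WeylType} {n : ℕ}

/-- The images of the `s_{ij}`. -/
def reflS (T : WeylType) {n : ℕ} (G : weylGroup T n → A) (i j : Fin n) : A := G (s T i j)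

/-- The images of the `s̄_{ij}`, taken to be zero in type `A`. -/
def reflBar : (T : WeylType) → {n : ℕ} → (weylGroup T n → A) → Fin n → Fin n → A
  | .A, _, _, _, _ => 0
  | .D, _, G, i, j => G (sBarD i j)
  | .B, _, G, i, j => G (sBarB i j)

/-- The images of the `τ_i`, taken to be zero in types `A` and `D`. -/
def reflTau : (T : WeylType) → {n : ℕ} → (weylGroup T n → A) → Fin n → A
  | .A, _, _, _ => 0
  | .D, _, _, _ => 0
  | .B, _, G, i => G (tauB i)

variable (F) in
/-- The family `Z` is permuted with signs by the conjugation with the `G w`. -/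
def Equivariant (G : weylGroup T n → A) (Z : Fin n → A) : Prop :=
  ∀ w i, G w * Z i = ((w.1.sgn i : ℤ) : F) • (Z (w.1.idx i) * G w)

omit [Ring A] in
theorem reflS_comm (G : weylGroup T n → A) (i j : Fin n) : reflS T G i j = reflS T G j i :=
  congrArg G (Subtype.ext (transp_comm i j))

theorem reflBar_comm (G : weylGroup T n → A) (i j : Fin n) : reflBar T G i j = reflBar T G j i := by
  cases T
  · rfl
  · exact congrArg G (Subtype.ext (transpBar_comm i j))
  · exact congrArg G (Subtype.ext (transpBar_comm i j))

theorem Equivariant.mul_pos {G : weylGroup T n → A} {Z : Fin n → A} (h : Equivariant F G Z)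
    {w : weylGroup T n} {i k : Fin n} (h1 : w.1.idx i = k) (h2 : w.1.sgn i = 1) :
    G w * Z i = Z k * G w := by
  rw [h, h1, h2]
  simp

theorem Equivariant.mul_neg {G : weylGroup T n → A} {Z : Fin n → A} (h : Equivariant F G Z)
    {w : weylGroup T n} {i k : Fin n} (h1 : w.1.idx i = k) (h2 : w.1.sgn i = -1) :
    G w * Z i = -(Z k * G w) := by
  rw [h, h1, h2]
  simp

/-- The hypothesis `i ≠ j` is essential: the two sign changes cancel for `i = j`, and `s̄_{ii}` is
the identity. -/
theorem Equivariant.bar {G : weylGroup T n → A} {Z : Fin n → A} (h : Equivariant F G Z)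
    {w : weylGroup T n} {i j : Fin n} (hij : i ≠ j) (hw : w.1 = transpBar i j) :
    G w * Z i = -(Z j * G w) ∧ G w * Z j = -(Z i * G w) := by
  refine ⟨h.mul_neg ?_ ?_, h.mul_neg ?_ ?_⟩
  · rw [hw, idx_transpBar, Equiv.swap_apply_left]
  · rw [hw, sgn_transpBar hij]; simp
  · rw [hw, idx_transpBar, Equiv.swap_apply_right]
  · rw [hw, sgn_transpBar hij]; simp

theorem Equivariant.bar_ne {G : weylGroup T n → A} {Z : Fin n → A} (h : Equivariant F G Z)
    {w : weylGroup T n} {i j k : Fin n} (hw : w.1 = transpBar i j) (h1 : k ≠ i) (h2 : k ≠ j) :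
    G w * Z k = Z k * G w := by
  refine h.mul_pos ?_ ?_
  · rw [hw, idx_transpBar, Equiv.swap_apply_of_ne_of_ne h1 h2]
  · rw [hw]
    -- Since `i = j` is allowed here, the sign is read off from the definition instead of
    -- `sgn_transpBar`.
    change (Pi.mulSingle i (-1) * Pi.mulSingle j (-1) : Fin n → ℤˣ) (Equiv.swap i j k) = _
    simp [Equiv.swap_apply_of_ne_of_ne h1 h2, h1, h2]

theorem Equivariant.reflects {G : weylGroup T n → A} {Z : Fin n → A} (h : Equivariant F G Z) :
    Reflects (reflS T G) (reflBar T G) (reflTau T G) Z where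
  s_left i j := h.mul_pos (Equiv.swap_apply_left i j) rfl
  s_right i j := h.mul_pos (Equiv.swap_apply_right i j) rfl
  s_ne i j k h1 h2 := h.mul_pos (Equiv.swap_apply_of_ne_of_ne h1 h2) rfl
  sb_left i j hij := by
    cases T
    · simp [reflBar]
    · exact (h.bar hij rfl).1
    · exact (h.bar hij rfl).1
  sb_right i j hij := by
    cases T
    · simp [reflBar]
    · exact (h.bar hij rfl).2
    · exact (h.bar hij rfl).2
  sb_ne i j k h1 h2 := by
    cases T
    · simp [reflBar]
    · exact h.bar_ne rfl h1 h2
    · exact h.bar_ne rfl h1 h2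
  tau_same i := by
    cases T
    · simp [reflTau]
    · simp [reflTau]
    · exact h.mul_neg rfl (by rw [tauB, sgn_signChange, if_pos rfl])
  tau_ne i j hij := by
    cases T
    · simp [reflTau]
    · simp [reflTau]
    · exact h.mul_pos rfl (by rw [tauB, sgn_signChange, if_neg hij])

theorem mul_reflS {G : weylGroup T n → A} (hG : ∀ w z, G (w * z) = G w * G z) (w : weylGroup T n)
    {i j : Fin n} (h : w.1.sgn i = w.1.sgn j) :
    G w * reflS T G i j = reflS T G (w.1.idx i) (w.1.idx j) * G w := by
  rw [reflS, reflS, ← hG, ← hG]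
  exact congrArg G (Subtype.ext (SignedPerm.mul_transp h))

theorem mul_reflS_of_ne {G : weylGroup T n → A} (hG : ∀ w z, G (w * z) = G w * G z)
    (w : weylGroup T n) {i j : Fin n} (h : w.1.sgn i ≠ w.1.sgn j) :
    G w * reflS T G i j = reflBar T G (w.1.idx i) (w.1.idx j) * G w := by
  cases T
  · exact absurd (by rw [sgn_of_mem_A w.2, sgn_of_mem_A w.2]) h
  · rw [reflS, reflBar, ← hG, ← hG]
    exact congrArg G (Subtype.ext (SignedPerm.mul_transp_of_ne h))
  · rw [reflS, reflBar, ← hG, ← hG]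
    exact congrArg G (Subtype.ext (SignedPerm.mul_transp_of_ne h))

theorem mul_reflBar {G : weylGroup T n → A} (hG : ∀ w z, G (w * z) = G w * G z)
    (w : weylGroup T n) {i j : Fin n} (hij : i ≠ j) (h : w.1.sgn i = w.1.sgn j) :
    G w * reflBar T G i j = reflBar T G (w.1.idx i) (w.1.idx j) * G w := by
  cases T
  · simp [reflBar]
  · rw [reflBar, reflBar, ← hG, ← hG]
    exact congrArg G (Subtype.ext (SignedPerm.mul_transpBar hij h))
  · rw [reflBar, reflBar, ← hG, ← hG]
    exact congrArg G (Subtype.ext (SignedPerm.mul_transpBar hij h))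

theorem mul_reflBar_of_ne {G : weylGroup T n → A} (hG : ∀ w z, G (w * z) = G w * G z)
    (w : weylGroup T n) {i j : Fin n} (h : w.1.sgn i ≠ w.1.sgn j) :
    G w * reflBar T G i j = reflS T G (w.1.idx i) (w.1.idx j) * G w := by
  cases T
  · exact absurd (by rw [sgn_of_mem_A w.2, sgn_of_mem_A w.2]) h
  · rw [reflS, reflBar, ← hG, ← hG]
    exact congrArg G (Subtype.ext (SignedPerm.mul_transpBar_of_ne h))
  · rw [reflS, reflBar, ← hG, ← hG]
    exact congrArg G (Subtype.ext (SignedPerm.mul_transpBar_of_ne h))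

theorem mul_reflTau {G : weylGroup T n → A} (hG : ∀ w z, G (w * z) = G w * G z)
    (w : weylGroup T n) (i : Fin n) :
    G w * reflTau T G i = reflTau T G (w.1.idx i) * G w := by
  cases T
  · simp [reflTau]
  · simp [reflTau]
  · rw [reflTau, reflTau, ← hG, ← hG]
    exact congrArg G (Subtype.ext (SignedPerm.mul_signChange w.1 i))

theorem Equivariant.mul_mul_same {G : weylGroup T n → A} {C : Fin n → A} (h : Equivariant F G C)
    (w : weylGroup T n) {i j : Fin n} (hs : w.1.sgn j = w.1.sgn i) :
    G w * (C j * C i) = C (w.1.idx j) * C (w.1.idx i) * G w := by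
  rw [← mul_assoc, h, smul_mul_assoc, mul_assoc, h, mul_smul_comm, smul_smul, mul_assoc, hs,
    ← Int.cast_mul, ← Units.val_mul, Int.units_mul_self]
  simp

theorem Equivariant.mul_mul_of_ne {G : weylGroup T n → A} {C : Fin n → A}
    (h : Equivariant F G C) (w : weylGroup T n) {i j : Fin n} (hs : w.1.sgn j ≠ w.1.sgn i) :
    G w * (C j * C i) = -(C (w.1.idx j) * C (w.1.idx i) * G w) := by
  rw [← mul_assoc, h, smul_mul_assoc, mul_assoc, h, mul_smul_comm, smul_smul, mul_assoc,
    Int.units_ne_iff_eq_neg.1 hs, ← Int.cast_mul, ← Units.val_mul, neg_mul, Int.units_mul_self]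
  simp

section

variable {G : weylGroup T n → A} {C : Fin n → A} (hG : ∀ w z, G (w * z) = G w * G z)
  (hC : Equivariant F G C) (w : weylGroup T n) {j i : Fin n}
include hG hC

theorem mul_eps (h : w.1.sgn j = w.1.sgn i) :
    G w * eps C (reflS T G) j i = eps C (reflS T G) (w.1.idx j) (w.1.idx i) * G w := by
  rw [eps, ← mul_assoc, mul_add, hC.mul_mul_same w h, eps, mul_assoc _ (reflS _ _ _ _) (G w),
    ← mul_reflS hG w h]
  noncomm_ring

theorem mul_eps_of_ne (h : w.1.sgn j ≠ w.1.sgn i) :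
    G w * eps C (reflS T G) j i = epsBar C (reflBar T G) (w.1.idx j) (w.1.idx i) * G w := by
  rw [eps, ← mul_assoc, mul_add, hC.mul_mul_of_ne w h, epsBar, mul_assoc _ (reflBar _ _ _ _) (G w),
    ← mul_reflS_of_ne hG w h]
  noncomm_ring

theorem mul_epsBar (hij : j ≠ i) (h : w.1.sgn j = w.1.sgn i) :
    G w * epsBar C (reflBar T G) j i = epsBar C (reflBar T G) (w.1.idx j) (w.1.idx i) * G w := by
  rw [epsBar, ← mul_assoc, mul_sub, hC.mul_mul_same w h, epsBar, mul_assoc _ (reflBar _ _ _ _) (G w),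
    ← mul_reflBar hG w hij h]
  noncomm_ring

theorem mul_epsBar_of_ne (h : w.1.sgn j ≠ w.1.sgn i) :
    G w * epsBar C (reflBar T G) j i = eps C (reflS T G) (w.1.idx j) (w.1.idx i) * G w := by
  rw [epsBar, ← mul_assoc, mul_sub, hC.mul_mul_of_ne w h, eps, mul_assoc _ (reflS _ _ _ _) (G w),
    ← mul_reflBar_of_ne hG w h]
  noncomm_ring

/-- If `w` has equal signs at the two indices, it preserves the kinds `eps` and `epsBar`; if the
signs differ, it exchanges them. The diagonal kernel contains their sum, which is insensitive to the
exchange, and the off-diagonal one their difference, which changes sign exactly when the product of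
the two signs is `-1`. -/
theorem mul_kern (u v : F) (j i : Fin n) :
    G w * kern u v C (reflS T G) (reflBar T G) (reflTau T G) j i =
      (((w.1.sgn j : ℤ) : F) * ((w.1.sgn i : ℤ) : F)) •
        (kern u v C (reflS T G) (reflBar T G) (reflTau T G) (w.1.idx j) (w.1.idx i) * G w) := by
  rw [← Int.cast_mul, ← Units.val_mul]
  rcases eq_or_ne j i with rfl | hij
  · have key : G w * (∑ k ∈ Finset.univ.erase j,
          (eps C (reflS T G) k j + epsBar C (reflBar T G) k j)) =
        (∑ k ∈ Finset.univ.erase (w.1.idx j), (eps C (reflS T G) k (w.1.idx j) +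
          epsBar C (reflBar T G) k (w.1.idx j))) * G w := by
      rw [Finset.mul_sum, Finset.sum_mul]
      refine Finset.sum_equiv w.1.right (fun k => ?_) (fun k hk => ?_)
      · simp [SignedPerm.idx]
      · have hkj := (Finset.mem_erase.1 hk).1
        change _ = (eps C (reflS T G) (w.1.idx k) (w.1.idx j) +
          epsBar C (reflBar T G) (w.1.idx k) (w.1.idx j)) * G w
        by_cases h : w.1.sgn k = w.1.sgn j
        · rw [mul_add, add_mul, mul_eps hG hC w h, mul_epsBar hG hC w hkj h]
        · rw [mul_add, add_mul, mul_eps_of_ne hG hC w h, mul_epsBar_of_ne hG hC w h, add_comm]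
    rw [kern_self, kern_self, Int.units_mul_self, mul_sub, sub_mul, mul_neg, neg_mul,
      mul_smul_comm, mul_smul_comm, smul_mul_assoc, smul_mul_assoc, key, mul_reflTau hG]
    simp
  · rw [kern_ne _ _ _ _ _ _ hij, kern_ne _ _ _ _ _ _ (w.1.idx_injective.ne hij), mul_smul_comm,
      smul_mul_assoc, smul_comm]
    congr 1
    by_cases h : w.1.sgn j = w.1.sgn i
    · rw [mul_sub, sub_mul, mul_eps hG hC w h, mul_epsBar hG hC w hij h, h, Int.units_mul_self]
      simp
    · rw [mul_sub, sub_mul, mul_eps_of_ne hG hC w h, mul_epsBar_of_ne hG hC w h,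
        Int.units_ne_iff_eq_neg.1 h, neg_mul, Int.units_mul_self]
      simp

end

end Equivariance

/-! ### Modules induced from the subalgebra generated by `𝒞_n`, `W` and `F[𝔥]` -/

section Induced

variable {F : Type*} [Field F] {n : ℕ} {M N : Type*} [AddCommGroup M] [Module F M]
  [AddCommGroup N] [Module F N]

variable (F n M) in
/-- The vector space `F[𝔥*] ⊗ M` underlying the induced module. -/
def Ind : Type _ := MvPolynomial (Fin n) F ⊗[F] M

instance : AddCommGroup (Ind F n M) :=
  inferInstanceAs (AddCommGroup (MvPolynomial (Fin n) F ⊗[F] M))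

instance : Module F (Ind F n M) :=
  inferInstanceAs (Module F (MvPolynomial (Fin n) F ⊗[F] M))

variable (F n M) in
/-- The canonical bilinear map to `F[𝔥*] ⊗ M`. -/
def Ind.mk : MvPolynomial (Fin n) F →ₗ[F] M →ₗ[F] Ind F n M :=
  TensorProduct.mk F (MvPolynomial (Fin n) F) M

variable (F M) in
/-- Multiplication by `x_i` on `F[𝔥*] ⊗ M`. -/
def indX (i : Fin n) : Module.End F (Ind F n M) :=
  (LinearMap.mulLeft F (MvPolynomial.X i : MvPolynomial (Fin n) F)).rTensor M

theorem indX_tmul (i : Fin n) (p : MvPolynomial (Fin n) F) (m : M) :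
    indX F M i (Ind.mk F n M p m) = Ind.mk F n M (MvPolynomial.X i * p) m := rfl

theorem Ind.ext_mk {f g : Ind F n M →ₗ[F] N}
    (h : ∀ p m, f (Ind.mk F n M p m) = g (Ind.mk F n M p m)) : f = g :=
  TensorProduct.ext' h

theorem indX_comm (i j : Fin n) : indX F M i * indX F M j = indX F M j * indX F M i := by
  refine Ind.ext_mk fun p m => ?_
  rw [Module.End.mul_apply, Module.End.mul_apply, indX_tmul, indX_tmul, indX_tmul, indX_tmul,
    mul_left_comm]

/-- Induction on the degree in the `x_i`: `F[𝔥*] ⊗ M` is generated from `1 ⊗ M` by the operators of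
multiplication by the `x_i`. -/
theorem Ind.induction {P : Submodule F (Ind F n M)} (h1 : ∀ m : M, Ind.mk F n M 1 m ∈ P)
    (h2 : ∀ i, ∀ z ∈ P, indX F M i z ∈ P) (z : Ind F n M) : z ∈ P := by
  have key : ∀ p m, Ind.mk F n M p m ∈ P := by
    intro p m
    induction p using MvPolynomial.induction_on with
    | C a =>
      have h : (MvPolynomial.C a : MvPolynomial (Fin n) F) = a • 1 := by
        rw [MvPolynomial.smul_eq_C_mul, mul_one]
      rw [h, map_smul]
      exact P.smul_mem a (h1 m)
    | add p q hp hq =>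
      rw [map_add]
      exact P.add_mem hp hq
    | mul_X p i hp =>
      rw [mul_comm, ← indX_tmul]
      exact h2 i _ hp
  exact TensorProduct.induction_on z P.zero_mem key fun a b => P.add_mem

/-- The form in which every relation on the induced module is checked: on `1 ⊗ M` it is a relation
of `M`, and it must propagate from `z` to `x_i z`. -/
theorem Ind.ext {f g : Ind F n M →ₗ[F] N} (h1 : ∀ m : M, f (Ind.mk F n M 1 m) = g (Ind.mk F n M 1 m))
    (h2 : ∀ i z, f z = g z → f (indX F M i z) = g (indX F M i z)) : f = g :=
  LinearMap.ext fun z => Ind.induction (P := LinearMap.eqLocus f g) h1 h2 z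

/-- The linear map `F[𝔥*] ⊗ M → N` extending `f` that intertwines the multiplication by the `x_i`
with the commuting operators `Z i`. -/
def indLift (Z : Fin n → Module.End F N) (hZ : ∀ i j, Z i * Z j = Z j * Z i) (f : M →ₗ[F] N) :
    Ind F n M →ₗ[F] N :=
  TensorProduct.lift (LinearMap.lcomp F N f ∘ₗ (polyHom Z hZ).toLinearMap)

theorem indLift_tmul (Z : Fin n → Module.End F N) (hZ : ∀ i j, Z i * Z j = Z j * Z i)
    (f : M →ₗ[F] N) (p : MvPolynomial (Fin n) F) (m : M) :
    indLift Z hZ f (Ind.mk F n M p m) = polyHom Z hZ p (f m) := rfl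

theorem indLift_one (Z : Fin n → Module.End F N) (hZ : ∀ i j, Z i * Z j = Z j * Z i)
    (f : M →ₗ[F] N) (m : M) : indLift Z hZ f (Ind.mk F n M 1 m) = f m := by
  rw [indLift_tmul, map_one, Module.End.one_apply]

theorem indLift_indX (Z : Fin n → Module.End F N) (hZ : ∀ i j, Z i * Z j = Z j * Z i)
    (f : M →ₗ[F] N) (i : Fin n) (z : Ind F n M) :
    indLift Z hZ f (indX F M i z) = Z i (indLift Z hZ f z) := by
  have h : indLift Z hZ f ∘ₗ indX F M i = Z i ∘ₗ indLift Z hZ f := by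
    refine Ind.ext_mk fun p m => ?_
    rw [LinearMap.comp_apply, LinearMap.comp_apply, indX_tmul, indLift_tmul, indLift_tmul, map_mul,
      polyHom_X, Module.End.mul_apply]
  exact LinearMap.congr_fun h z

end Induced

/-! ### The relations as properties of families in an algebra -/

section Action

variable {F A : Type*} [Field F] [Ring A] [Algebra F A] {T : WeylType} {n : ℕ}

variable (F) in
/-- The relations among the `c_i` and the group elements. -/
structure IsCliffordWeylFamily (C : Fin n → A) (G : weylGroup T n → A) : Prop where
  clifford : IsCliffordFamily C
  one : G 1 = 1
  mul : ∀ w z, G (w * z) = G w * G z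
  equivariant : Equivariant F G C

variable (F) in
/-- The relations among the `y_i`, the `c_i` and the group elements. -/
structure IsLowerFamily (C Y : Fin n → A) (G : weylGroup T n → A) : Prop where
  cliffordWeyl : IsCliffordWeylFamily F C G
  comm : ∀ i j, Y i * Y j = Y j * Y i
  comm_c : ∀ i j, Y i * C j = C j * Y i
  equivariant : Equivariant F G Y

/-- The value of `[y_j, x_i]` in terms of the families of the `c_i` and the group elements. -/
def weylKern (u v : F) (C : Fin n → A) (G : weylGroup T n → A) (j i : Fin n) : A :=
  kern u v C (reflS T G) (reflBar T G) (reflTau T G) j i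

/-- The defining relations of the rational double affine Hecke–Clifford algebra. -/
structure IsHeckeCliffordFamily (u v : F) (X Y C : Fin n → A) (G : weylGroup T n → A) :
    Prop where
  lower : IsLowerFamily F C Y G
  comm : ∀ i j, X i * X j = X j * X i
  anti : AnticommutesDiagonally X C
  equivariant : Equivariant F G X
  commutator : ∀ j i, Y j * X i - X i * Y j = weylKern u v C G j i

end Action

/-! ### The action on the induced module -/

section IndAction

variable {F : Type*} [Field F] {T : WeylType} {n : ℕ} {M : Type*} [AddCommGroup M] [Module F M]
  (c y : Fin n → Module.End F M) (g : weylGroup T n → Module.End F M)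

/-- The sign in `c_j x_i = ± x_i c_j`. -/
def flipSign (j i : Fin n) : ℤˣ := if i = j then -1 else 1

theorem smul_indX_comm (a : Fin n → F) (σ : Fin n → Fin n) (i j : Fin n) :
    (a i • indX F M (σ i)) * (a j • indX F M (σ j)) =
      (a j • indX F M (σ j)) * (a i • indX F M (σ i)) := by
  rw [smul_mul_smul_comm, smul_mul_smul_comm, indX_comm, mul_comm (a i)]

/-- The action of `c_j` on `F[𝔥*] ⊗ M`. -/
def indC (j : Fin n) : Module.End F (Ind F n M) :=
  indLift (fun i => ((flipSign j i : ℤ) : F) • indX F M i)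
    (smul_indX_comm (fun i => ((flipSign j i : ℤ) : F)) id)
    (Ind.mk F n M 1 ∘ₗ c j)

/-- The action of `w` on `F[𝔥*] ⊗ M`. -/
def indG (w : weylGroup T n) : Module.End F (Ind F n M) :=
  indLift (fun i => ((w.1.sgn i : ℤ) : F) • indX F M (w.1.idx i))
    (smul_indX_comm (fun i => ((w.1.sgn i : ℤ) : F)) w.1.idx)
    (Ind.mk F n M 1 ∘ₗ g w)

theorem indC_one (j : Fin n) (m : M) : indC c j (Ind.mk F n M 1 m) = Ind.mk F n M 1 (c j m) :=
  indLift_one _ _ _ m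

theorem indG_one (w : weylGroup T n) (m : M) : indG g w (Ind.mk F n M 1 m) = Ind.mk F n M 1 (g w m) :=
  indLift_one _ _ _ m

theorem indC_indX (j i : Fin n) (z : Ind F n M) :
    indC c j (indX F M i z) = ((flipSign j i : ℤ) : F) • indX F M i (indC c j z) :=
  indLift_indX _ _ _ i z

theorem indG_indX (w : weylGroup T n) (i : Fin n) (z : Ind F n M) :
    indG g w (indX F M i z) = ((w.1.sgn i : ℤ) : F) • indX F M (w.1.idx i) (indG g w z) :=
  indLift_indX _ _ _ i z

theorem indX_anticommutes : AnticommutesDiagonally (indX F M) (indC c) where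
  same i := by
    refine LinearMap.ext fun z => ?_
    simp only [Module.End.mul_apply, indC_indX, flipSign, LinearMap.neg_apply, if_true,
      Units.val_neg, Units.val_one, Int.cast_neg, Int.cast_one, neg_smul, one_smul, neg_neg]
  ne i j h := by
    refine LinearMap.ext fun z => ?_
    simp [indC_indX, flipSign, h]

theorem indX_equivariant : Equivariant F (indG g) (indX F M) :=
  fun w i => LinearMap.ext fun z => indG_indX g w i z

variable {c y g}

theorem indG_equivariant_indC (h : IsCliffordWeylFamily F c g) :
    Equivariant F (indG g) (indC c) := by
  intro w i
  refine Ind.ext (fun m => ?_) (fun k z hz => ?_)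
  · have e := congrArg (Ind.mk F n M 1) (LinearMap.congr_fun (h.equivariant w i) m)
    simp only [Module.End.mul_apply, LinearMap.smul_apply, map_smul,
      indC_one, indG_one] at e ⊢
    exact e
  · have hf : flipSign (w.1.idx i) (w.1.idx k) = flipSign i k := by
      simp only [flipSign, w.1.idx_injective.eq_iff]
    simp only [Module.End.mul_apply, LinearMap.smul_apply] at hz ⊢
    simp only [indG_indX, indC_indX, map_smul, hz, hf, smul_smul]
    congr 1
    ring

theorem indC_clifford (h : IsCliffordFamily c) : IsCliffordFamily (indC c) where
  sq i := by
    refine Ind.ext (fun m => ?_) (fun k z hz => ?_)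
    · simp only [Module.End.mul_apply, indC_one, Module.End.one_apply]
      congr 1
      exact LinearMap.congr_fun (h.sq i) m
    · simp only [Module.End.mul_apply, Module.End.one_apply] at hz ⊢
      simp only [indC_indX, map_smul, hz, smul_smul]
      rw [← Int.cast_mul, ← Units.val_mul, Int.units_mul_self]
      simp
  anti i j hij := by
    refine Ind.ext (fun m => ?_) (fun k z hz => ?_)
    · have e := congrArg (Ind.mk F n M 1) (LinearMap.congr_fun (h.anti i j hij) m)
      simp only [Module.End.mul_apply, LinearMap.neg_apply, map_neg, indC_one] at e ⊢
      exact e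
    · simp only [Module.End.mul_apply, LinearMap.neg_apply] at hz ⊢
      simp only [indC_indX, map_smul, hz, smul_smul, map_neg, smul_neg]
      rw [mul_comm]

theorem ind_cliffordWeyl (h : IsCliffordWeylFamily F c g) :
    IsCliffordWeylFamily F (indC c) (indG g) where
  clifford := indC_clifford h.clifford
  one := by
    refine Ind.ext (fun m => ?_) (fun k z hz => ?_)
    · simp only [indG_one, h.one, Module.End.one_apply]
    · rw [indG_indX, hz]
      simp [SignedPerm.sgn_one, SignedPerm.idx_one]
  mul w z := by
    refine Ind.ext (fun m => ?_) (fun k p hp => ?_)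
    · simp only [indG_one, h.mul, Module.End.mul_apply]
    · simp only [Module.End.mul_apply] at hp ⊢
      simp only [indG_indX, map_smul, hp, smul_smul, Subgroup.coe_mul, SignedPerm.idx_mul,
        SignedPerm.sgn_mul]
      push_cast
      rw [mul_comm]
  equivariant := indG_equivariant_indC h

variable (u v : F)

/-- The value of `[y_j, x_i]` acting on `F[𝔥*] ⊗ M`. -/
def indKern (c : Fin n → Module.End F M) (g : weylGroup T n → Module.End F M)
    (j i : Fin n) : Module.End F (Ind F n M) :=
  weylKern u v (indC c) (indG g) j i

theorem indKern_comm_x (h : IsCliffordWeylFamily F c g) (j i k : Fin n) :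
    indKern u v c g j i * indX F M k - indX F M k * indKern u v c g j i =
      indKern u v c g j k * indX F M i - indX F M i * indKern u v c g j k :=
  kern_comm_x (indC_clifford h.clifford) (indX_anticommutes c) (indX_equivariant g).reflects
    (reflS_comm _) (reflBar_comm _) u v j i k

/-- The operator `(a, b) ↦ (x_i a, x_i b + [y_j, x_i] a)`. -/
def shearX (c : Fin n → Module.End F M) (g : weylGroup T n → Module.End F M) (j i : Fin n) :
    Module.End F (Ind F n M × Ind F n M) :=
  ((indX F M i) ∘ₗ LinearMap.fst F _ _).prod
    (indX F M i ∘ₗ LinearMap.snd F _ _ + indKern u v c g j i ∘ₗ LinearMap.fst F _ _)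

/-- The second components agree exactly when `[κ_{ji}, x_k] = [κ_{jk}, x_i]`, that is, by the Jacobi
identity `indKern_comm_x`. -/
theorem shearX_comm (h : IsCliffordWeylFamily F c g) (j i k : Fin n) :
    shearX u v c g j i * shearX u v c g j k = shearX u v c g j k * shearX u v c g j i := by
  refine LinearMap.ext fun z => Prod.ext ?_ ?_
  · exact LinearMap.congr_fun (indX_comm i k) z.1
  · have h1 := LinearMap.congr_fun (indKern_comm_x u v h j i k) z.1
    have h2 := LinearMap.congr_fun (indX_comm i k (F := F) (M := M)) z.2
    simp only [LinearMap.sub_apply, Module.End.mul_apply] at h1 h2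
    change indX F M i (indX F M k z.2 + indKern u v c g j k z.1) +
        indKern u v c g j i (indX F M k z.1) =
      indX F M k (indX F M i z.2 + indKern u v c g j i z.1) +
        indKern u v c g j k (indX F M i z.1)
    rw [map_add, map_add]
    rw [h2, add_assoc, add_assoc]
    congr 1
    rw [sub_eq_sub_iff_add_eq_add] at h1
    rw [add_comm, h1, add_comm]

/-- The action of `y_j` together with the identity, as a map into two copies of `F[𝔥*] ⊗ M`. -/
def indYAux (h : IsCliffordWeylFamily F c g) (y : Fin n → Module.End F M) (j : Fin n) :
    Ind F n M →ₗ[F] Ind F n M × Ind F n M :=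
  indLift (shearX u v c g j) (shearX_comm u v h j)
    ((Ind.mk F n M 1).prod
      (Ind.mk F n M 1 ∘ₗ y j))

/-- The action of `y_j` on `F[𝔥*] ⊗ M`. -/
def indY (h : IsCliffordWeylFamily F c g) (y : Fin n → Module.End F M) (j : Fin n) :
    Module.End F (Ind F n M) :=
  LinearMap.snd F _ _ ∘ₗ indYAux u v h y j

/-- The auxiliary map is `z ↦ (z, y_j z)`. Keeping `z` itself as first component turns the
inhomogeneous recursion `y_j x_i z = x_i y_j z + κ_{ji} z` into an intertwining property with the
commuting shears, which `indLift` can solve. -/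
theorem fst_indYAux (h : IsCliffordWeylFamily F c g) (j : Fin n) (z : Ind F n M) :
    (indYAux u v h y j z).1 = z := by
  have e : LinearMap.fst F _ _ ∘ₗ indYAux u v h y j = LinearMap.id := by
    refine Ind.ext (fun m => ?_) (fun k z hz => ?_)
    · simp [indYAux, indLift_one]
    · simp only [LinearMap.comp_apply, LinearMap.fst_apply, LinearMap.id_apply] at hz ⊢
      rw [indYAux, indLift_indX]
      change indX F M k (indYAux u v h y j z).1 = _
      rw [hz]
  exact LinearMap.congr_fun e z

theorem indY_one (h : IsCliffordWeylFamily F c g) (j : Fin n) (m : M) :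
    indY u v h y j (Ind.mk F n M 1 m) = Ind.mk F n M 1 (y j m) := by
  simp [indY, indYAux, indLift_one]

theorem indY_indX (h : IsCliffordWeylFamily F c g) (j i : Fin n) (z : Ind F n M) :
    indY u v h y j (indX F M i z) = indX F M i (indY u v h y j z) + indKern u v c g j i z := by
  have e : indY u v h y j (indX F M i z) =
      indX F M i (indY u v h y j z) + indKern u v c g j i (indYAux u v h y j z).1 := by
    rw [indY, LinearMap.comp_apply, indYAux, indLift_indX]
    rfl
  rw [e, fst_indYAux]

variable (hl : IsLowerFamily F c y g)
include hl

/-- In the inductive step `y_i` leaves a term with `κ_{ik}`, which passes `c_j` with the same sign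
as `x_k`. -/
theorem indY_comm_c (i j : Fin n) :
    indY u v hl.cliffordWeyl y i * indC c j = indC c j * indY u v hl.cliffordWeyl y i := by
  have hS := (ind_cliffordWeyl hl.cliffordWeyl).equivariant.reflects
  refine Ind.ext (fun m => ?_) (fun k z hz => ?_)
  · simp only [Module.End.mul_apply, indC_one, indY_one]
    congr 1
    exact LinearMap.congr_fun (hl.comm_c i j) m
  · simp only [Module.End.mul_apply] at hz ⊢
    rw [indC_indX, map_smul, indY_indX, indY_indX, map_add, indC_indX, hz, smul_add]
    congr 1
    rcases eq_or_ne k j with rfl | hkj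
    · have e := LinearMap.congr_fun
        (kern_mul_c_same (indC_clifford hl.cliffordWeyl.clifford) hS u v i k) z
      simp only [Module.End.mul_apply, LinearMap.neg_apply] at e
      simp only [flipSign, if_true, indKern, weylKern, e]
      simp
    · have e := LinearMap.congr_fun
        (kern_mul_c_ne (indC_clifford hl.cliffordWeyl.clifford) hS u v (j := i) hkj.symm) z
      simp only [Module.End.mul_apply] at e
      simp only [flipSign, if_neg hkj, indKern, weylKern, e]
      simp

theorem indY_equivariant : Equivariant F (indG g) (indY u v hl.cliffordWeyl y) := by
  have hc := ind_cliffordWeyl hl.cliffordWeyl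
  intro w i
  refine Ind.ext (fun m => ?_) (fun k z hz => ?_)
  · have e := congrArg (Ind.mk F n M 1) (LinearMap.congr_fun (hl.equivariant w i) m)
    simp only [Module.End.mul_apply, LinearMap.smul_apply, map_smul,
      indY_one, indG_one] at e ⊢
    exact e
  · have e : indG g w (indKern u v c g i k z) = (((w.1.sgn i : ℤ) : F) * ((w.1.sgn k : ℤ) : F)) •
        indKern u v c g (w.1.idx i) (w.1.idx k) (indG g w z) :=
      LinearMap.congr_fun (mul_kern hc.mul hc.equivariant w u v i k) z
    simp only [Module.End.mul_apply, LinearMap.smul_apply] at hz ⊢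
    simp only [indY_indX, map_add, indG_indX, hz, e, map_smul, smul_smul, smul_add]
    rw [mul_comm]

/-- Expanding `y_i y_j x_k z` gives `x_k y_i y_j z + κ_{ik} y_j z + y_i κ_{jk} z`. The last two
terms together are symmetric in `i, j` by `kern_comm_y`, whose hypotheses on the induced `y` are the
two preceding theorems. -/
theorem indY_comm (i j : Fin n) :
    indY u v hl.cliffordWeyl y i * indY u v hl.cliffordWeyl y j =
      indY u v hl.cliffordWeyl y j * indY u v hl.cliffordWeyl y i := by
  refine Ind.ext (fun m => ?_) (fun k z hz => ?_)
  · simp only [Module.End.mul_apply, indY_one]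
    congr 1
    exact LinearMap.congr_fun (hl.comm i j) m
  · have e : indKern u v c g j k (indY u v hl.cliffordWeyl y i z) -
          indY u v hl.cliffordWeyl y i (indKern u v c g j k z) =
        indKern u v c g i k (indY u v hl.cliffordWeyl y j z) -
          indY u v hl.cliffordWeyl y j (indKern u v c g i k z) :=
      LinearMap.congr_fun (kern_comm_y (indY_comm_c u v hl)
        (indY_equivariant u v hl).reflects u v k i j) z
    simp only [Module.End.mul_apply] at hz ⊢
    rw [sub_eq_sub_iff_add_eq_add] at e
    simp only [indY_indX, map_add, hz]
    rw [add_assoc, add_assoc, e]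

theorem ind_heckeClifford :
    IsHeckeCliffordFamily u v (indX F M) (indY u v hl.cliffordWeyl y) (indC c) (indG g) where
  lower :=
    { cliffordWeyl := ind_cliffordWeyl hl.cliffordWeyl
      comm := indY_comm u v hl
      comm_c := indY_comm_c u v hl
      equivariant := indY_equivariant u v hl }
  comm := indX_comm
  anti := indX_anticommutes c
  equivariant := indX_equivariant g
  commutator j i := LinearMap.ext fun z => by
    simp [indY_indX, indKern]

end IndAction

/-! ### The defining relations -/

section Universal

variable {F A : Type*} [Field F] [Algebra ℂ F] [Ring A] [Algebra F A] {T : WeylType} {n : ℕ}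

-- One formula serves all types: the `s̄` part is zero in type `A`, and the order of the indices of
-- `s` and `s̄`, which differs between the types, is irrelevant.
omit [Algebra ℂ F] in
theorem map_offDiag (f : Free F T n →ₐ[F] A) (u v : F) {j i : Fin n} (h : j ≠ i) :
    f (offDiag T u j i) = weylKern u v (fun k => f (fc F k)) (fun w => f (fw F w)) j i := by
  rw [weylKern, kern_ne _ _ _ _ _ _ h, eps, epsBar, reflS_comm, reflBar_comm]
  cases T
  · have e : s .A j i = s .A i j := Subtype.ext (transp_comm j i)
    simp [offDiag, reflS, reflBar, e]
  · simp [offDiag, reflS, reflBar]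
  · simp [offDiag, reflS, reflBar]

theorem map_diag (f : Free F T n →ₐ[F] A) (u v : F) (i : Fin n) :
    f (diag T u v i) = weylKern u (algebraMap ℂ F (Real.sqrt 2 : ℂ) * v) (fun k => f (fc F k))
      (fun w => f (fw F w)) i i := by
  rw [weylKern, kern_self]
  cases T
  · simp [diag, reflS, reflBar, reflTau, eps, epsBar]
  · simp [diag, reflS, reflBar, reflTau, eps, epsBar]
  · simp [diag, reflS, reflBar, reflTau, eps, epsBar]

omit [Algebra ℂ F] in
theorem conj_of_equivariant {G : weylGroup T n → A} {Z : Fin n → A} (h1 : G 1 = 1)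
    (hG : ∀ w z, G (w * z) = G w * G z) (h : Equivariant F G Z) (w : weylGroup T n) (i : Fin n) :
    G w * Z i * G w⁻¹ = ((w.1.sgn i : ℤ) : F) • Z (w.1.idx i) := by
  rw [h, smul_mul_assoc, mul_assoc, ← hG, mul_inv_cancel, h1, mul_one]

omit [Algebra ℂ F] in
theorem equivariant_of_conj {G : weylGroup T n → A} {Z : Fin n → A} (h1 : G 1 = 1)
    (hG : ∀ w z, G (w * z) = G w * G z)
    (h : ∀ w i, G w * Z i * G w⁻¹ = ((w.1.sgn i : ℤ) : F) • Z (w.1.idx i)) :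
    Equivariant F G Z := by
  intro w i
  rw [← smul_mul_assoc, ← h, mul_assoc, ← hG, inv_mul_cancel, h1, mul_one]

variable {u v : F} {X Y C : Fin n → A} {G : weylGroup T n → A}

/-- The homomorphism from the free algebra with the given values on the generators. -/
def freeLift (X Y C : Fin n → A) (G : weylGroup T n → A) : Free F T n →ₐ[F] A :=
  FreeAlgebra.lift F fun
    | .x i => X i
    | .y i => Y i
    | .c i => C i
    | .w w => G w

omit [Algebra ℂ F] in
theorem freeLift_x (i : Fin n) : freeLift X Y C G (fx F i) = X i := FreeAlgebra.lift_ι_apply _ _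

omit [Algebra ℂ F] in
theorem freeLift_y (i : Fin n) : freeLift X Y C G (fy F i) = Y i := FreeAlgebra.lift_ι_apply _ _

omit [Algebra ℂ F] in
theorem freeLift_c (i : Fin n) : freeLift X Y C G (fc F i) = C i := FreeAlgebra.lift_ι_apply _ _

omit [Algebra ℂ F] in
theorem freeLift_w (w : weylGroup T n) : freeLift X Y C G (fw F w) = G w :=
  FreeAlgebra.lift_ι_apply _ _

theorem freeLift_rel
    (h : IsHeckeCliffordFamily u (algebraMap ℂ F (Real.sqrt 2 : ℂ) * v) X Y C G)
    ⦃a b : Free F T n⦄ (hab : Rel T n u v a b) : freeLift X Y C G a = freeLift X Y C G b := by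
  have hw := h.lower.cliffordWeyl
  induction hab with
  | w_one => rw [freeLift_w, map_one, hw.one]
  | w_mul w z => simp only [map_mul, freeLift_w, hw.mul]
  | c_sq i => rw [map_mul, map_one, freeLift_c, hw.clifford.sq]
  | c_anti i j hij => simp only [map_mul, map_neg, freeLift_c, hw.clifford.anti i j hij]
  | xx i j => simp only [map_mul, freeLift_x, h.comm i j]
  | yy i j => simp only [map_mul, freeLift_y, h.lower.comm i j]
  | yc i j => simp only [map_mul, freeLift_y, freeLift_c, h.lower.comm_c i j]
  | xc_same i => simp only [map_mul, map_neg, freeLift_x, freeLift_c, h.anti.same i]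
  | xc i j hij => simp only [map_mul, freeLift_x, freeLift_c, h.anti.ne i j hij]
  | conj_x w i =>
    simp only [map_mul, map_smul, freeLift_x, freeLift_w]
    exact conj_of_equivariant hw.one hw.mul h.equivariant w i
  | conj_y w i =>
    simp only [map_mul, map_smul, freeLift_y, freeLift_w]
    exact conj_of_equivariant hw.one hw.mul h.lower.equivariant w i
  | conj_c w i =>
    simp only [map_mul, map_smul, freeLift_c, freeLift_w]
    exact conj_of_equivariant hw.one hw.mul hw.equivariant w i
  | yx_ne i j hij =>
    rw [map_offDiag _ _ (algebraMap ℂ F (Real.sqrt 2 : ℂ) * v) hij.symm]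
    simp only [map_sub, map_mul, freeLift_x, freeLift_y, freeLift_c, freeLift_w, h.commutator]
  | yx_eq i =>
    rw [map_diag]
    simp only [map_sub, map_mul, freeLift_x, freeLift_y, freeLift_c, freeLift_w, h.commutator]

/-- The universal property of the rational double affine Hecke–Clifford algebra. -/
def algLift (h : IsHeckeCliffordFamily u (algebraMap ℂ F (Real.sqrt 2 : ℂ) * v) X Y C G) :
    Alg T n u v →ₐ[F] A :=
  RingQuot.liftAlgHom F ⟨freeLift X Y C G, freeLift_rel h⟩

section

variable (h : IsHeckeCliffordFamily u (algebraMap ℂ F (Real.sqrt 2 : ℂ) * v) X Y C G)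

theorem algLift_x (i : Fin n) : algLift h (x T u v i) = X i := by
  rw [algLift, x, RingQuot.liftAlgHom_mkAlgHom_apply, freeLift_x]

theorem algLift_y (i : Fin n) : algLift h (y T u v i) = Y i := by
  rw [algLift, y, RingQuot.liftAlgHom_mkAlgHom_apply, freeLift_y]

theorem algLift_c (i : Fin n) : algLift h (c T u v i) = C i := by
  rw [algLift, c, RingQuot.liftAlgHom_mkAlgHom_apply, freeLift_c]

theorem algLift_g (w : weylGroup T n) : algLift h (g T u v w) = G w := by
  rw [algLift, g, RingQuot.liftAlgHom_mkAlgHom_apply, freeLift_w]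

end

variable (T u v) in
theorem alg_family : IsHeckeCliffordFamily u (algebraMap ℂ F (Real.sqrt 2 : ℂ) * v)
    (x T u v (n := n)) (y T u v) (c T u v) (g T u v) where
  lower :=
    { cliffordWeyl :=
        { clifford := ⟨c_sq T u v, c_anti T u v⟩
          one := g_one T u v
          mul := g_mul T u v
          equivariant := equivariant_of_conj (g_one T u v) (g_mul T u v) fun w i => by
            simpa only [g, c, map_mul, map_smul] using
              RingQuot.mkAlgHom_rel F (Rel.conj_c (u := u) (v := v) w i) }
      comm := y_comm T u v
      comm_c := fun i j => by
        simpa only [y, c, map_mul] using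
          RingQuot.mkAlgHom_rel F (Rel.yc (T := T) (u := u) (v := v) i j)
      equivariant := equivariant_of_conj (g_one T u v) (g_mul T u v) fun w i => by
        simpa only [g, y, map_mul, map_smul] using
          RingQuot.mkAlgHom_rel F (Rel.conj_y (u := u) (v := v) w i) }
  comm := x_comm T u v
  anti :=
    { same := fun i => by
        simpa only [x, c, map_mul, map_neg] using
          RingQuot.mkAlgHom_rel F (Rel.xc_same (T := T) (u := u) (v := v) i)
      ne := fun i j h => by
        simpa only [x, c, map_mul] using
          RingQuot.mkAlgHom_rel F (Rel.xc (T := T) (u := u) (v := v) i j h) }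
  equivariant := equivariant_of_conj (g_one T u v) (g_mul T u v) fun w i => by
    simpa only [g, x, map_mul, map_smul] using
      RingQuot.mkAlgHom_rel F (Rel.conj_x (u := u) (v := v) w i)
  commutator j i := by
    rcases eq_or_ne j i with rfl | h
    · have e := RingQuot.mkAlgHom_rel F (Rel.yx_eq (T := T) (u := u) (v := v) j)
      rw [map_diag, map_sub, map_mul, map_mul] at e
      exact e
    · have e := RingQuot.mkAlgHom_rel F (Rel.yx_ne (T := T) (u := u) (v := v) i j h.symm)
      rw [map_offDiag _ _ (algebraMap ℂ F (Real.sqrt 2 : ℂ) * v) h, map_sub, map_mul, map_mul] at e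
      exact e

/-- The generators of the free algebra map to generators of its quotient. -/
theorem alg_induction {P : Subalgebra F (Alg T n u v)} (hx : ∀ i, x T u v i ∈ P)
    (hy : ∀ i, y T u v i ∈ P) (hc : ∀ i, c T u v i ∈ P) (hg : ∀ w, g T u v w ∈ P) : P = ⊤ := by
  rw [eq_top_iff]
  rintro a -
  obtain ⟨b, rfl⟩ := RingQuot.mkAlgHom_surjective F (Rel T n u v) a
  change b ∈ P.comap (RingQuot.mkAlgHom F (Rel T n u v))
  induction b using FreeAlgebra.induction with
  | grade0 r => exact Subalgebra.algebraMap_mem _ r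
  | grade1 i =>
    cases i with
    | x i => exact hx i
    | y i => exact hy i
    | c i => exact hc i
    | w w => exact hg w
  | mul a b ha hb => exact Subalgebra.mul_mem _ ha hb
  | add a b ha hb => exact Subalgebra.add_mem _ ha hb

end Universal

/-! ### Ordered monomials in the Clifford algebra -/

section Monomials

variable {A : Type*} [Ring A]

/-- The ordered product `a_1^{ε_1} ⋯ a_n^{ε_n}`. -/
def cliffMon {n : ℕ} (a : Fin n → A) (ε : Fin n → ZMod 2) : A :=
  (List.ofFn fun i => a i ^ (ε i).val).prod

theorem cliffMon_zero {n : ℕ} (a : Fin n → A) : cliffMon a 0 = 1 := by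
  simp [cliffMon]

theorem cliffMon_succ {n : ℕ} (a : Fin (n + 1) → A) (ε : Fin (n + 1) → ZMod 2) :
    cliffMon a ε = a 0 ^ (ε 0).val * cliffMon (fun i => a i.succ) (fun i => ε i.succ) := by
  simp [cliffMon, List.ofFn_succ]

theorem IsCliffordFamily.mul_pow {n : ℕ} {a : Fin n → A} (h : IsCliffordFamily a) {i j : Fin n}
    (hij : i ≠ j) (e : ℕ) :
    a i * a j ^ e = a j ^ e * a i ∨ a i * a j ^ e = -(a j ^ e * a i) := by
  induction e with
  | zero => simp
  | succ e ih =>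
    rw [pow_succ, ← mul_assoc]
    rcases ih with ih | ih
    · right
      rw [ih, mul_assoc, h.anti i j hij, mul_neg, mul_assoc]
    · left
      rw [ih, neg_mul, mul_assoc, h.anti i j hij, mul_neg, neg_neg, mul_assoc]

theorem IsCliffordFamily.mul_cliffMon {n : ℕ} {a : Fin n → A} (h : IsCliffordFamily a) (i : Fin n)
    (ε : Fin n → ZMod 2) :
    a i * cliffMon a ε = cliffMon a (ε + Pi.single i 1) ∨
      a i * cliffMon a ε = -cliffMon a (ε + Pi.single i 1) := by
  induction n with
  | zero => exact i.elim0
  | succ n ih =>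
    rw [cliffMon_succ, cliffMon_succ, ← mul_assoc]
    induction i using Fin.cases with
    | zero =>
      left
      have e1 : (fun k : Fin n => (ε + (Pi.single 0 1 : Fin (n + 1) → ZMod 2)) k.succ) = fun k => ε k.succ := by
        funext k
        simp [Fin.succ_ne_zero]
      -- Exponents live in `ZMod 2`; the carry from `1 + 1` to `0` is absorbed by `c² = 1`.
      have e2 : ∀ b : ZMod 2, a 0 * a 0 ^ b.val = a 0 ^ (b + 1).val := by
        intro b
        fin_cases b
        · change a 0 * a 0 ^ 0 = a 0 ^ 1
          simp
        · change a 0 * a 0 ^ 1 = a 0 ^ 0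
          rw [pow_one, h.sq, pow_zero]
      rw [e1, e2]
      simp
    | succ i =>
      have ht : IsCliffordFamily fun k : Fin n => a k.succ :=
        ⟨fun k => h.sq _, fun k l hkl => h.anti _ _ (Fin.succ_injective n |>.ne hkl)⟩
      have e1 : (fun k : Fin n => (ε + (Pi.single i.succ 1 : Fin (n + 1) → ZMod 2)) k.succ) =
          (fun k => ε k.succ) + Pi.single i 1 := by
        funext k
        simp [Pi.single_apply]
      have e2 : (ε + (Pi.single i.succ 1 : Fin (n + 1) → ZMod 2)) 0 = ε 0 := by
        simp [(Fin.succ_ne_zero i).symm]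
      rw [e1, e2]
      rcases h.mul_pow (Fin.succ_ne_zero i) (ε 0).val with h1 | h1 <;>
        rcases ih ht i (fun k => ε k.succ) with h2 | h2 <;>
        rw [h1] <;> simp only [neg_mul, mul_assoc, h2, mul_neg, neg_neg, true_or, or_true]

end Monomials

/-! ### The ordered monomials form a basis of the Clifford algebra -/

section CliffordBasis

variable {F : Type*} [Field F] {n : ℕ}

variable (F) in
/-- The generator `c_i` of the Clifford algebra. -/
def cl (i : Fin n) : Cl F n := CliffordAlgebra.ι (stdForm F n) (Pi.single i 1)

theorem stdForm_apply (m : Fin n → F) : stdForm F n m = ∑ i, m i * m i := by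
  simp [stdForm, QuadraticMap.weightedSumSquares_apply]

theorem cl_isCliffordFamily : IsCliffordFamily (cl F (n := n)) where
  sq i := by
    rw [cl, CliffordAlgebra.ι_sq_scalar, stdForm_apply]
    simp [Pi.single_apply]
  anti i j h := by
    refine eq_neg_of_add_eq_zero_left ?_
    rw [cl, cl, CliffordAlgebra.ι_mul_ι_add_swap, QuadraticMap.polar, stdForm_apply, stdForm_apply,
      stdForm_apply, ← Finset.sum_sub_distrib, ← Finset.sum_sub_distrib, Finset.sum_eq_zero,
      map_zero]
    intro k _
    rcases eq_or_ne k i with rfl | hk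
    · simp [h]
    · simp [hk]

theorem Cl.adjoin_range_cl : Algebra.adjoin F (Set.range (cl F (n := n))) = ⊤ := by
  rw [eq_top_iff, ← CliffordAlgebra.adjoin_range_ι]
  refine Algebra.adjoin_le ?_
  rintro _ ⟨m, rfl⟩
  have e : m = ∑ i, m i • Pi.single i (1 : F) := by
    rw [← Finset.univ_sum_single m]
    refine Finset.sum_congr rfl fun i _ => ?_
    rw [← Pi.single_smul]
    simp
  rw [e, map_sum]
  refine Subalgebra.sum_mem _ fun i _ => ?_
  rw [map_smul]
  exact Subalgebra.smul_mem _ (Algebra.subset_adjoin (Set.mem_range_self i)) _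

theorem Cl.eq_top {P : Subalgebra F (Cl F n)} (h : ∀ i, cl F i ∈ P) : P = ⊤ := by
  rw [eq_top_iff, ← Cl.adjoin_range_cl]
  exact Algebra.adjoin_le (Set.range_subset_iff.2 h)

theorem Cl.hom_ext {A : Type*} [Ring A] [Algebra F A] {f f' : Cl F n →ₐ[F] A}
    (h : ∀ i, f (cl F i) = f' (cl F i)) : f = f' :=
  AlgHom.ext_of_adjoin_eq_top Cl.adjoin_range_cl (by rintro _ ⟨i, rfl⟩; exact h i)

/-- The elements that map a submodule to itself by left multiplication. -/
def leftStabilizer {A : Type*} [Ring A] [Algebra F A] (P : Submodule F A) : Subalgebra F A where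
  carrier := {a | ∀ z ∈ P, a * z ∈ P}
  mul_mem' ha hb z hz := by
    rw [mul_assoc]
    exact ha _ (hb z hz)
  add_mem' ha hb z hz := by
    rw [add_mul]
    exact P.add_mem (ha z hz) (hb z hz)
  algebraMap_mem' r z hz := by
    rw [← Algebra.smul_def]
    exact P.smul_mem r hz

theorem eq_top_of_leftStabilizer {A : Type*} [Ring A] [Algebra F A] {P : Submodule F A}
    (h : leftStabilizer P = ⊤) (h1 : 1 ∈ P) : P = ⊤ := by
  rw [eq_top_iff]
  rintro a -
  have ha : a ∈ leftStabilizer P := h ▸ Algebra.mem_top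
  simpa using ha 1 h1

/-- Left multiplication by a generator permutes the ordered monomials up to sign, so their span is a
left ideal; it contains `1`. -/
theorem span_cliffMon : Submodule.span F (Set.range (cliffMon (cl F (n := n)))) = ⊤ := by
  refine eq_top_of_leftStabilizer (Cl.eq_top fun i z hz => ?_)
    (Submodule.subset_span ⟨0, cliffMon_zero _⟩)
  induction hz using Submodule.span_induction with
  | mem z hz =>
    obtain ⟨ε, rfl⟩ := hz
    rcases (cl_isCliffordFamily (F := F)).mul_cliffMon i ε with h | h
    · rw [h]
      exact Submodule.subset_span ⟨_, rfl⟩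
    · rw [h]
      exact Submodule.neg_mem _ (Submodule.subset_span ⟨_, rfl⟩)
  | zero =>
    rw [mul_zero]
    exact Submodule.zero_mem _
  | add a b _ _ ha hb =>
    rw [mul_add]
    exact Submodule.add_mem _ ha hb
  | smul r a _ ha =>
    rw [mul_smul_comm]
    exact Submodule.smul_mem _ r ha

/-- The sign `(-1)^a`. -/
def parity (a : ZMod 2) : ℤ := (-1) ^ a.val

theorem parity_add_one (a : ZMod 2) : parity (a + 1) = -parity a := by
  revert a; decide

theorem parity_mul_self (a : ZMod 2) : parity a * parity a = 1 := by
  revert a; decide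

/-- The sign `∏_{k < i} (-1)^{η_k}` in the action of `c_i` on the ordered monomials. -/
def spinSign (i : Fin n) (η : Fin n → ZMod 2) : ℤ := ∏ k ∈ Finset.univ.filter (· < i), parity (η k)

theorem spinSign_mul_self (i : Fin n) (η : Fin n → ZMod 2) : spinSign i η * spinSign i η = 1 := by
  rw [spinSign, ← Finset.prod_mul_distrib]
  exact Finset.prod_eq_one fun k _ => parity_mul_self _

theorem spinSign_add_of_lt {i j : Fin n} (h : j < i) (η : Fin n → ZMod 2) :
    spinSign i (η + Pi.single j 1) = -spinSign i η := by
  have hj : j ∈ Finset.univ.filter (· < i) := by simp [h]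
  rw [spinSign, spinSign, ← Finset.mul_prod_erase _ _ hj, ← Finset.mul_prod_erase _ _ hj]
  rw [Pi.add_apply, Pi.single_eq_same, parity_add_one, neg_mul]
  congr 2
  refine Finset.prod_congr rfl fun k hk => ?_
  rw [Pi.add_apply, Pi.single_eq_of_ne (Finset.mem_erase.1 hk).1, add_zero]

theorem spinSign_add_of_le {i j : Fin n} (h : i ≤ j) (η : Fin n → ZMod 2) :
    spinSign i (η + Pi.single j 1) = spinSign i η := by
  refine Finset.prod_congr rfl fun k hk => ?_
  have hk' : k ≠ j := ((Finset.mem_filter.1 hk).2.trans_le h).ne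
  rw [Pi.add_apply, Pi.single_eq_of_ne hk', add_zero]

theorem add_single_add_single (i : Fin n) (η : Fin n → ZMod 2) :
    η + Pi.single i 1 + Pi.single i 1 = η := by
  rw [add_assoc, ← Pi.single_add, show (1 + 1 : ZMod 2) = 0 from rfl, Pi.single_zero, add_zero]

variable (F) in
/-- The action of `c_i` on the functions on `(ℤ/2)ⁿ`. -/
def spinC (i : Fin n) : Module.End F ((Fin n → ZMod 2) → F) where
  toFun f η := (spinSign i η : F) * f (η + Pi.single i 1)
  map_add' f g := by
    funext η
    simp [mul_add]
  map_smul' r f := by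
    funext η
    simp [mul_left_comm]

theorem spinC_apply (i : Fin n) (f : (Fin n → ZMod 2) → F) (η : Fin n → ZMod 2) :
    spinC F i f η = (spinSign i η : F) * f (η + Pi.single i 1) := rfl

theorem spinC_anti_of_lt {i j : Fin n} (h : i < j) :
    spinC F i * spinC F j = -(spinC F j * spinC F i) := by
  refine LinearMap.ext fun f => funext fun η => ?_
  rw [LinearMap.neg_apply, Pi.neg_apply, Module.End.mul_apply, Module.End.mul_apply, spinC_apply,
    spinC_apply, spinC_apply, spinC_apply, spinSign_add_of_lt h, spinSign_add_of_le h.le,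
    add_right_comm]
  push_cast
  ring

theorem spinC_isCliffordFamily : IsCliffordFamily (spinC F (n := n)) where
  sq i := by
    refine LinearMap.ext fun f => funext fun η => ?_
    rw [Module.End.mul_apply, spinC_apply, spinC_apply, spinSign_add_of_le le_rfl,
      add_single_add_single, ← mul_assoc, ← Int.cast_mul, spinSign_mul_self, Int.cast_one, one_mul,
      Module.End.one_apply]
  anti i j h := by
    rcases lt_or_gt_of_ne h with h | h
    · exact spinC_anti_of_lt h
    · rw [spinC_anti_of_lt h, neg_neg]

/-- Each `c_i` flips the `i`-th bit of a delta function up to a sign, which is its own inverse in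
`F`. -/
theorem spinC_single (i : Fin n) (ε : Fin n → ZMod 2) :
    ∃ r : Fˣ, spinC F i (Pi.single ε 1) = r • Pi.single (ε + Pi.single i 1) (1 : F) := by
  have hr : (spinSign i ε : F) * (spinSign i ε : F) = 1 := by
    rw [← Int.cast_mul, spinSign_mul_self, Int.cast_one]
  refine ⟨⟨spinSign i ε, spinSign i ε, hr, hr⟩, funext fun η => ?_⟩
  rw [spinC_apply, Pi.smul_apply, Units.smul_def, smul_eq_mul, Pi.single_apply, Pi.single_apply]
  by_cases h : η = ε + Pi.single i 1
  · rw [if_pos h, h, add_single_add_single, if_pos rfl, spinSign_add_of_le le_rfl]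
  · rw [if_neg h, if_neg, mul_zero, mul_zero]
    intro h'
    exact h (by rw [← h', add_single_add_single])

theorem spinC_pow_single (i : Fin n) (e : ZMod 2) (ε : Fin n → ZMod 2) :
    ∃ r : Fˣ, (spinC F i ^ e.val) (Pi.single ε 1) = r • Pi.single (Pi.single i e + ε) (1 : F) := by
  fin_cases e
  · refine ⟨1, ?_⟩
    change (spinC F i ^ 0) _ = (1 : Fˣ) • Pi.single (Pi.single i (0 : ZMod 2) + ε) _
    simp
  · obtain ⟨r, hr⟩ := spinC_single (F := F) i ε
    refine ⟨r, ?_⟩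
    change (spinC F i ^ 1) _ = r • Pi.single (Pi.single i (1 : ZMod 2) + ε) _
    rw [pow_one, hr, add_comm]

/-- The indices come from an arbitrary map `φ : Fin m → Fin n` so that the induction can strip the
first factor while `n` stays fixed. The case of interest is `φ = id`. -/
theorem spinC_prod_single {m : ℕ} (φ : Fin m → Fin n) (ε : Fin m → ZMod 2) :
    ∃ r : Fˣ, (List.ofFn fun k => spinC F (φ k) ^ (ε k).val).prod (Pi.single 0 1) =
      r • Pi.single (∑ k, Pi.single (φ k) (ε k)) (1 : F) := by
  induction m with
  | zero => exact ⟨1, by simp⟩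
  | succ m ih =>
    obtain ⟨r, hr⟩ := ih (fun k => φ k.succ) (fun k => ε k.succ)
    obtain ⟨r', hr'⟩ := spinC_pow_single (F := F) (φ 0) (ε 0)
      (∑ k : Fin m, Pi.single (φ k.succ) (ε k.succ))
    refine ⟨r * r', ?_⟩
    rw [List.ofFn_succ, List.prod_cons, Module.End.mul_apply, hr, Units.smul_def, map_smul, hr',
      Fin.sum_univ_succ, mul_smul, Units.smul_def r]

variable [Algebra ℂ F]

variable (F n) in
/-- The action of the Clifford algebra on the functions on `(ℤ/2)ⁿ`. -/
def spinRep : Cl F n →ₐ[F] Module.End F ((Fin n → ZMod 2) → F) :=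
  CliffordAlgebra.lift (stdForm F n) ⟨Fintype.linearCombination F (spinC F),
    clifford_sq (spinC F) spinC_isCliffordFamily.sq spinC_isCliffordFamily.anti⟩

omit [Algebra ℂ F] in
theorem map_cliffMon {A B : Type*} [Ring A] [Ring B] [Algebra F A] [Algebra F B] (f : A →ₐ[F] B)
    (a : Fin n → A) (ε : Fin n → ZMod 2) :
    f (cliffMon a ε) = cliffMon (fun i => f (a i)) ε := by
  rw [cliffMon, map_list_prod, List.map_ofFn]
  simp [cliffMon, Function.comp_def]

/-- In the spin module `c^ε δ_0` is `δ_ε` up to a unit, and the delta functions are independent. -/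
theorem linearIndependent_cliffMon : LinearIndependent F (cliffMon (cl F (n := n))) := by
  have h : ∀ ε : Fin n → ZMod 2, ∃ r : Fˣ,
      spinRep F n (cliffMon (cl F) ε) (Pi.single 0 1) = r • Pi.single ε (1 : F) := by
    intro ε
    obtain ⟨r, hr⟩ := spinC_prod_single (F := F) id ε
    refine ⟨r, ?_⟩
    have e : ∀ i, spinRep F n (cl F i) = spinC F i := by
      intro i
      simp [spinRep, cl]
    rw [map_cliffMon]
    simp only [e]
    simp only [id, Finset.univ_sum_single] at hr
    exact hr
  choose r hr using h
  refine LinearIndependent.of_comp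
    (LinearMap.applyₗ (Pi.single 0 1) ∘ₗ (spinRep F n).toLinearMap) ?_
  convert (Pi.linearIndependent_single_one (Fin n → ZMod 2) F).units_smul r using 1
  funext ε
  exact hr ε

variable (F n) in
/-- The basis of the ordered monomials of the Clifford algebra. -/
def clBasis : Module.Basis (Fin n → ZMod 2) F (Cl F n) :=
  Module.Basis.mk linearIndependent_cliffMon span_cliffMon.ge

theorem clBasis_apply (ε : Fin n → ZMod 2) : clBasis F n ε = cliffMon (cl F) ε :=
  Module.Basis.mk_apply _ _ ε

end CliffordBasis

/-! ### A faithful module -/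

section Lower

variable {F R : Type*} [Field F] [Ring R] [Algebra F R] {T : WeylType} {n : ℕ}

variable (F T) in
/-- The operator on functions `W → R` that multiplies the value at `z` by `z⁻¹(a_i)`. -/
def twistMul (a : Fin n → R) (i : Fin n) : Module.End F (weylGroup T n → R) where
  toFun f z := ((z⁻¹.1.sgn i : ℤ) : F) • (a (z⁻¹.1.idx i) * f z)
  map_add' f f' := by
    funext z
    simp [mul_add]
  map_smul' r f := by
    funext z
    simp [smul_comm r]

variable (F R) in
/-- Left translation of functions `W → R`. -/
def translate (w : weylGroup T n) : Module.End F (weylGroup T n → R) where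
  toFun f z := f (w⁻¹ * z)
  map_add' _ _ := rfl
  map_smul' _ _ := rfl

theorem twistMul_apply (a : Fin n → R) (i : Fin n) (f : weylGroup T n → R) (z : weylGroup T n) :
    twistMul F T a i f z = ((z⁻¹.1.sgn i : ℤ) : F) • (a (z⁻¹.1.idx i) * f z) := rfl

theorem translate_apply (w : weylGroup T n) (f : weylGroup T n → R) (z : weylGroup T n) :
    translate F R w f z = f (w⁻¹ * z) := rfl

theorem twistMul_mul (a b : Fin n → R) (i j : Fin n) (f : weylGroup T n → R)
    (z : weylGroup T n) :
    (twistMul F T a i * twistMul F T b j) f z =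
      (((z⁻¹.1.sgn i : ℤ) : F) * ((z⁻¹.1.sgn j : ℤ) : F)) •
        (a (z⁻¹.1.idx i) * b (z⁻¹.1.idx j) * f z) := by
  rw [Module.End.mul_apply, twistMul_apply, twistMul_apply, mul_smul_comm, smul_smul, mul_assoc]

theorem twistMul_comm {a b : Fin n → R} (h : ∀ i j, a i * b j = b j * a i) (i j : Fin n) :
    twistMul F T a i * twistMul F T b j = twistMul F T b j * twistMul F T a i := by
  refine LinearMap.ext fun f => funext fun z => ?_
  rw [twistMul_mul, twistMul_mul, h, mul_comm ((z⁻¹.1.sgn i : ℤ) : F)]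

theorem twistMul_clifford {a : Fin n → R} (h : IsCliffordFamily a) :
    IsCliffordFamily (twistMul F T a) where
  sq i := by
    refine LinearMap.ext fun f => funext fun z => ?_
    rw [twistMul_mul, h.sq, ← Int.cast_mul, ← Units.val_mul, Int.units_mul_self]
    simp
  anti i j hij := by
    refine LinearMap.ext fun f => funext fun z => ?_
    rw [LinearMap.neg_apply, Pi.neg_apply, twistMul_mul, twistMul_mul,
      h.anti _ _ (z⁻¹.1.idx_injective.ne hij), mul_comm ((z⁻¹.1.sgn i : ℤ) : F), neg_mul, smul_neg]

/-- The value at `z` stands for the coefficient `r` of `z ⊗ r`, and `a (z ⊗ r) = z ⊗ z⁻¹(a) r`.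
Translation by `w` replaces `z` by `w⁻¹ z`, whose inverse is `z⁻¹ w`; the factor `w` is what acts on
`a_i`. -/
theorem twistMul_equivariant (a : Fin n → R) : Equivariant F (translate F R) (twistMul F T a) := by
  intro w i
  refine LinearMap.ext fun f => funext fun z => ?_
  rw [LinearMap.smul_apply, Pi.smul_apply, Module.End.mul_apply, Module.End.mul_apply,
    translate_apply, twistMul_apply, twistMul_apply, translate_apply, mul_inv_rev, inv_inv,
    Subgroup.coe_mul, SignedPerm.sgn_mul, SignedPerm.idx_mul, smul_smul]
  push_cast
  rw [mul_comm ((w.1.sgn i : ℤ) : F)]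

theorem twist_lower {a b : Fin n → R} (ha : IsCliffordFamily a)
    (hb : ∀ i j, b i * b j = b j * b i) (hba : ∀ i j, b i * a j = a j * b i) :
    IsLowerFamily F (twistMul F T a) (twistMul F T b) (translate F R) where
  cliffordWeyl :=
    { clifford := twistMul_clifford ha
      one := LinearMap.ext fun f => funext fun z => by simp [translate_apply]
      mul := fun w z => LinearMap.ext fun f => funext fun t => by
        rw [Module.End.mul_apply, translate_apply, translate_apply, translate_apply, mul_inv_rev,
          mul_assoc]
      equivariant := twistMul_equivariant a }
  comm := twistMul_comm hb
  comm_c := twistMul_comm hba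
  equivariant := twistMul_equivariant b

theorem translate_single [DecidableEq (weylGroup T n)] (w z : weylGroup T n) (r : R) :
    translate F R w (Pi.single z r) = Pi.single (w * z) r := by
  funext t
  rw [translate_apply, Pi.single_apply, Pi.single_apply]
  simp only [inv_mul_eq_iff_eq_mul]

theorem twistMul_single_one [DecidableEq (weylGroup T n)] (a : Fin n → R) (i : Fin n) (r : R) :
    twistMul F T a i (Pi.single 1 r) = Pi.single 1 (a i * r) := by
  funext t
  rw [twistMul_apply]
  rcases eq_or_ne t 1 with rfl | h
  · rw [Pi.single_eq_same, Pi.single_eq_same, inv_one]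
    change ((SignedPerm.sgn 1 i : ℤ) : F) • (a (SignedPerm.idx 1 i) * r) = _
    rw [SignedPerm.sgn_one, SignedPerm.idx_one]
    simp
  · rw [Pi.single_eq_of_ne h, Pi.single_eq_of_ne h, mul_zero, smul_zero]

end Lower

/-! ### The action of signed permutations on the Clifford algebra -/

section CliffordTwist

variable {F : Type*} [Field F] [Algebra ℂ F] {n : ℕ}

omit [Algebra ℂ F] in
theorem smul_cl_isCliffordFamily (w : SignedPerm n) :
    IsCliffordFamily fun i => ((w.sgn i : ℤ) : F) • cl F (w.idx i) where
  sq i := by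
    rw [smul_mul_smul_comm, cl_isCliffordFamily.sq, ← Int.cast_mul, ← Units.val_mul,
      Int.units_mul_self]
    simp
  anti i j h := by
    rw [smul_mul_smul_comm, smul_mul_smul_comm, cl_isCliffordFamily.anti _ _ (w.idx_injective.ne h),
      mul_comm ((w.sgn i : ℤ) : F), smul_neg]

variable (F) in
/-- The action of a signed permutation on the Clifford algebra. -/
def clAct (w : SignedPerm n) : Cl F n →ₐ[F] Cl F n :=
  CliffordAlgebra.lift (stdForm F n)
    ⟨Fintype.linearCombination F fun i => ((w.sgn i : ℤ) : F) • cl F (w.idx i),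
      clifford_sq _ (smul_cl_isCliffordFamily w).sq (smul_cl_isCliffordFamily w).anti⟩

theorem clAct_cl (w : SignedPerm n) (i : Fin n) :
    clAct F w (cl F i) = ((w.sgn i : ℤ) : F) • cl F (w.idx i) := by
  simp [clAct, cl]

theorem clAct_one : clAct F (1 : SignedPerm n) = AlgHom.id F _ :=
  Cl.hom_ext fun i => by
    rw [clAct_cl, SignedPerm.sgn_one, SignedPerm.idx_one]
    simp

theorem clAct_mul (w z : SignedPerm n) : clAct F (w * z) = (clAct F w).comp (clAct F z) :=
  Cl.hom_ext fun i => by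
    rw [AlgHom.comp_apply, clAct_cl, clAct_cl, map_smul, clAct_cl, SignedPerm.sgn_mul,
      SignedPerm.idx_mul, smul_smul]
    push_cast
    rw [mul_comm]

theorem clAct_injective (w : SignedPerm n) : Function.Injective (clAct F w) := by
  refine Function.LeftInverse.injective (g := clAct F w⁻¹) fun a => ?_
  rw [← AlgHom.comp_apply, ← clAct_mul, inv_mul_cancel, clAct_one, AlgHom.id_apply]

end CliffordTwist

/-! ### Linear independence of the ordered products -/

section Faithful

variable {F : Type*} [Field F] [Algebra ℂ F] (T : WeylType) (n : ℕ) (u v : F)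

theorem cHom_cl (i : Fin n) : cHom T n u v (cl F i) = c T u v i := cHom_ι T n u v i

/-- The coefficients of the functions on `W`. -/
abbrev Coeff (F : Type*) [Field F] (n : ℕ) : Type _ := Cl F n ⊗[F] MvPolynomial (Fin n) F

omit [Algebra ℂ F] in
variable (F) in
theorem coeff_lower : IsLowerFamily F
    (twistMul F T fun i : Fin n => (cl F i ⊗ₜ 1 : Coeff F n))
    (twistMul F T fun i : Fin n => (1 ⊗ₜ MvPolynomial.X i : Coeff F n))
    (translate F (Coeff F n)) := by
  refine twist_lower ⟨fun i => ?_, fun i j h => ?_⟩ (fun i j => ?_) (fun i j => ?_)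
  · rw [Algebra.TensorProduct.tmul_mul_tmul, cl_isCliffordFamily.sq, one_mul]
    rfl
  · rw [Algebra.TensorProduct.tmul_mul_tmul, Algebra.TensorProduct.tmul_mul_tmul,
      cl_isCliffordFamily.anti i j h, TensorProduct.neg_tmul]
  · rw [Algebra.TensorProduct.tmul_mul_tmul, Algebra.TensorProduct.tmul_mul_tmul, mul_comm
      (MvPolynomial.X i)]
  · rw [Algebra.TensorProduct.tmul_mul_tmul, Algebra.TensorProduct.tmul_mul_tmul, one_mul, one_mul,
      mul_one, mul_one]

/-- The representation of `H_W` on `F[𝔥*] ⊗ (W → 𝒞_n ⊗ F[𝔥])`. -/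
def rep : Alg T n u v →ₐ[F] Module.End F (Ind F n (weylGroup T n → Coeff F n)) :=
  algLift (ind_heckeClifford u (algebraMap ℂ F (Real.sqrt 2 : ℂ) * v) (coeff_lower F T n))

theorem rep_xHom (p : MvPolynomial (Fin n) F) (m : weylGroup T n → Coeff F n) :
    rep T n u v (xHom T n u v p) (Ind.mk F n _ 1 m) = Ind.mk F n _ p m := by
  induction p using MvPolynomial.induction_on with
  | C a =>
    have h : (MvPolynomial.C a : MvPolynomial (Fin n) F) = a • 1 := by
      rw [MvPolynomial.smul_eq_C_mul, mul_one]
    rw [h]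
    simp only [map_smul, map_one, LinearMap.smul_apply, Module.End.one_apply]
  | add p q hp hq => simp only [map_add, LinearMap.add_apply, hp, hq]
  | mul_X p i hp =>
    rw [mul_comm, map_mul, map_mul, Module.End.mul_apply, hp, xHom_X, rep, algLift_x, indX_tmul]

theorem rep_g [DecidableEq (weylGroup T n)] (w : weylGroup T n) (r : Coeff F n) :
    rep T n u v (g T u v w) (Ind.mk F n _ 1 (Pi.single 1 r)) =
      Ind.mk F n _ 1 (Pi.single w r) := by
  rw [rep, algLift_g, indG_one, translate_single, mul_one]

theorem rep_yHom [DecidableEq (weylGroup T n)] (q : MvPolynomial (Fin n) F) :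
    rep T n u v (yHom T n u v q) (Ind.mk F n _ 1 (Pi.single 1 1)) =
      Ind.mk F n _ 1 (Pi.single 1 ((1 : Cl F n) ⊗ₜ[F] q : Coeff F n)) := by
  induction q using MvPolynomial.induction_on with
  | C a =>
    have h : (MvPolynomial.C a : MvPolynomial (Fin n) F) = a • 1 := by
      rw [MvPolynomial.smul_eq_C_mul, mul_one]
    rw [h]
    simp only [map_smul, map_one, LinearMap.smul_apply, Module.End.one_apply,
      TensorProduct.tmul_smul, Pi.single_smul]
    rfl
  | add p q hp hq =>
    simp only [map_add, LinearMap.add_apply, hp, hq, TensorProduct.tmul_add, Pi.single_add]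
  | mul_X p i hp =>
    rw [mul_comm, map_mul, map_mul, Module.End.mul_apply, hp, yHom_X, rep, algLift_y, indY_one,
      twistMul_single_one, Algebra.TensorProduct.tmul_mul_tmul, one_mul]

/-- The set of `a` for which this holds for all `m` is a subalgebra containing the generators.
Quantifying over `m` makes it closed under products. -/
theorem rep_cHom (a : Cl F n) (m : weylGroup T n → Coeff F n) :
    rep T n u v (cHom T n u v a) (Ind.mk F n _ 1 m) =
      Ind.mk F n _ 1 fun z => (clAct F z⁻¹.1 a ⊗ₜ 1) * m z := by
  let P : Subalgebra F (Cl F n) :=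
    { carrier := {a | ∀ m : weylGroup T n → Coeff F n,
        rep T n u v (cHom T n u v a) (Ind.mk F n _ 1 m) =
          Ind.mk F n _ 1 fun z => (clAct F z⁻¹.1 a ⊗ₜ 1) * m z}
      mul_mem' := fun {a b} ha hb m => by
        rw [map_mul, map_mul, Module.End.mul_apply, hb, ha]
        simp only [map_mul, ← mul_assoc, Algebra.TensorProduct.tmul_mul_tmul, mul_one]
      add_mem' := fun {a b} ha hb m => by
        rw [map_add, map_add, LinearMap.add_apply, hb, ha, ← map_add]
        congr 1
        funext z
        rw [map_add, TensorProduct.add_tmul, add_mul]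
        rfl
      algebraMap_mem' := fun r m => by
        rw [AlgHom.commutes, AlgHom.commutes, Module.algebraMap_end_apply, ← map_smul]
        congr 1
        funext z
        rw [AlgHom.commutes, Pi.smul_apply, Algebra.algebraMap_eq_smul_one,
          ← TensorProduct.smul_tmul', smul_mul_assoc]
        exact congrArg _ (one_mul _).symm }
  have hP : P = ⊤ := Cl.eq_top fun i m => by
    rw [cHom_cl, rep, algLift_c, indC_one]
    congr 1
    funext z
    rw [twistMul_apply, clAct_cl, ← TensorProduct.smul_tmul', smul_mul_assoc]
  exact (hP ▸ Algebra.mem_top : a ∈ P) m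

/-- The factors act from right to left, and those from the lower algebra never leave `1 ⊗ M`; the
`x` act last. Hence no `y` ever meets an `x`, and the parameters `u`, `v` do not appear. -/
theorem rep_mulMap [DecidableEq (weylGroup T n)] (p q : MvPolynomial (Fin n) F) (a : Cl F n)
    (w : weylGroup T n) :
    rep T n u v (xHom T n u v p * cHom T n u v a * g T u v w * yHom T n u v q)
        (Ind.mk F n _ 1 (Pi.single 1 1)) =
      Ind.mk F n _ p (Pi.single w (clAct F w⁻¹.1 a ⊗ₜ q)) := by
  rw [map_mul, map_mul, map_mul, Module.End.mul_apply, Module.End.mul_apply, Module.End.mul_apply,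
    rep_yHom, rep_g, rep_cHom, rep_xHom]
  congr 1
  funext z
  rcases eq_or_ne z w with rfl | h
  · rw [Pi.single_eq_same, Pi.single_eq_same, Algebra.TensorProduct.tmul_mul_tmul, mul_one, one_mul]
  · rw [Pi.single_eq_of_ne h, Pi.single_eq_of_ne h, mul_zero]

/-- The tensor basis of `F[𝔥*] ⊗ 𝒞_n ⊗ F W ⊗ F[𝔥]`. -/
def tensorBasis : Module.Basis ((((Fin n →₀ ℕ) × (Fin n → ZMod 2)) × weylGroup T n) × (Fin n →₀ ℕ))
    F (((MvPolynomial (Fin n) F ⊗[F] Cl F n) ⊗[F] MonoidAlgebra F (weylGroup T n)) ⊗[F]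
      MvPolynomial (Fin n) F) :=
  (((MvPolynomial.basisMonomials (Fin n) F).tensorProduct (clBasis F n)).tensorProduct
    (MonoidAlgebra.basis (weylGroup T n) F)).tensorProduct (MvPolynomial.basisMonomials (Fin n) F)

theorem mulMap_tensorBasis
    (t : (((Fin n →₀ ℕ) × (Fin n → ZMod 2)) × weylGroup T n) × (Fin n →₀ ℕ)) :
    mulMap T n u v (tensorBasis T n t) =
      xHom T n u v (MvPolynomial.monomial t.1.1.1 1) * cHom T n u v (cliffMon (cl F) t.1.1.2) *
        g T u v t.1.2 * yHom T n u v (MvPolynomial.monomial t.2 1) := by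
  obtain ⟨⟨⟨α, ε⟩, w⟩, γ⟩ := t
  simp only [tensorBasis, Module.Basis.tensorProduct_apply, MvPolynomial.coe_basisMonomials,
    clBasis_apply, mulMap_tmul]
  congr 2
  exact wHom_of T n u v w

omit [Algebra ℂ F] in
theorem linearIndependent_tmul {V V' ι κ : Type*} [AddCommGroup V] [Module F V] [AddCommGroup V']
    [Module F V'] {a : ι → V} {b : κ → V'} (ha : LinearIndependent F a)
    (hb : LinearIndependent F b) : LinearIndependent F fun t : ι × κ => a t.1 ⊗ₜ[F] b t.2 :=
  LinearIndependent.tmul_of_flat_left ha hb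

omit [Algebra ℂ F] in
theorem linearIndependent_monomial :
    LinearIndependent F fun α : Fin n →₀ ℕ => MvPolynomial.monomial α (1 : F) := by
  have h := (MvPolynomial.basisMonomials (Fin n) F).linearIndependent
  rwa [MvPolynomial.coe_basisMonomials] at h

omit [Algebra ℂ F] in
theorem linearIndependent_mk {M ι κ : Type*} [AddCommGroup M] [Module F M]
    {a : ι → MvPolynomial (Fin n) F} {b : κ → M} (ha : LinearIndependent F a)
    (hb : LinearIndependent F b) :
    LinearIndependent F fun t : ι × κ => Ind.mk F n M (a t.1) (b t.2) :=
  linearIndependent_tmul ha hb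

omit [Algebra ℂ F] in
theorem linearIndependent_algHom_tmul {R ι : Type*} [Ring R] [Algebra F R] {b : ι → R}
    (hb : LinearIndependent F b) (f : R →ₐ[F] R) (hf : Function.Injective f) :
    LinearIndependent F fun t : ι × (Fin n →₀ ℕ) =>
      f (b t.1) ⊗ₜ[F] MvPolynomial.monomial t.2 (1 : F) :=
  linearIndependent_tmul (a := fun i => f (b i)) (b := fun γ => MvPolynomial.monomial γ (1 : F))
    (hb.map' f.toLinearMap (LinearMap.ker_eq_bot.2 hf)) (linearIndependent_monomial n)

omit [Algebra ℂ F] in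
theorem linearIndependent_mk_single {V ι κ W : Type*} [AddCommGroup V] [Module F V]
    [DecidableEq W] {a : ι → MvPolynomial (Fin n) F} {b : W → κ → V} (ha : LinearIndependent F a)
    (hb : ∀ w, LinearIndependent F (b w)) :
    LinearIndependent F fun t : ι × (Σ _ : W, κ) =>
      Ind.mk F n (W → V) (a t.1) (Pi.single t.2.1 (b t.2.1 t.2.2)) :=
  linearIndependent_mk n (b := fun t : Σ _ : W, κ => (Pi.single t.1 (b t.1 t.2) : W → V)) ha
    (Pi.linearIndependent_single b hb)

omit [Algebra ℂ F] in
theorem injective_of_linearIndependent_basis {V V' ι : Type*} [AddCommMonoid V] [Module F V]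
    [AddCommMonoid V'] [Module F V'] (b : Module.Basis ι F V) (f : V →ₗ[F] V')
    (h : LinearIndependent F fun i => f (b i)) : Function.Injective f := by
  have e : f = Finsupp.linearCombination F (fun i => f (b i)) ∘ₗ b.repr.toLinearMap :=
    b.ext fun i => by simp
  rw [e, LinearMap.coe_comp]
  exact Function.Injective.comp h b.repr.injective

/-- The rearrangement of the index set of the tensor basis. -/
def pbwIndexEquiv (W : Type*) :
    (((Fin n →₀ ℕ) × (Fin n → ZMod 2)) × W) × (Fin n →₀ ℕ) ≃
      (Fin n →₀ ℕ) × (Σ _ : W, (Fin n → ZMod 2) × (Fin n →₀ ℕ)) where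
  toFun t := (t.1.1.1, ⟨t.1.2, (t.1.1.2, t.2)⟩)
  invFun t := (((t.1, t.2.2.1), t.2.1), t.2.2.2)
  left_inv _ := rfl
  right_inv _ := rfl

/-- The orbit map of the cyclic vector. -/
def orbitMap [DecidableEq (weylGroup T n)] :
    Alg T n u v →ₗ[F] Ind F n (weylGroup T n → Coeff F n) :=
  LinearMap.applyₗ (Ind.mk F n _ 1 (Pi.single 1 1)) ∘ₗ (rep T n u v).toLinearMap

theorem orbitMap_tensorBasis [DecidableEq (weylGroup T n)]
    (t : (((Fin n →₀ ℕ) × (Fin n → ZMod 2)) × weylGroup T n) × (Fin n →₀ ℕ)) :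
    orbitMap T n u v (mulMap T n u v (tensorBasis T n t)) =
      Ind.mk F n _ (MvPolynomial.monomial t.1.1.1 1) (Pi.single t.1.2
        (clAct F t.1.2⁻¹.1 (cliffMon (cl F) t.1.1.2) ⊗ₜ[F] MvPolynomial.monomial t.2 (1 : F))) := by
  rw [mulMap_tensorBasis]
  exact rep_mulMap T n u v _ _ _ _

/-- For fixed `w` the elements `w⁻¹(c^ε) ⊗ y^γ` are independent because `w⁻¹` acts injectively on
`𝒞_n`; different `w` have disjoint supports; and tensoring with the monomials `x^α` preserves
independence. -/
theorem linearIndependent_orbit [DecidableEq (weylGroup T n)] :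
    LinearIndependent F fun t => orbitMap T n u v (mulMap T n u v (tensorBasis T n t)) := by
  have h := linearIndependent_mk_single (W := weylGroup T n) n (linearIndependent_monomial n)
    (fun w => linearIndependent_algHom_tmul n linearIndependent_cliffMon (clAct F w⁻¹.1)
      (clAct_injective w⁻¹.1))
  rw [← linearIndependent_equiv (pbwIndexEquiv n (weylGroup T n))] at h
  have e : (fun t => orbitMap T n u v (mulMap T n u v (tensorBasis T n t))) = _ :=
    funext fun t => orbitMap_tensorBasis T n u v t
  rw [e]
  exact h

theorem mulMap_injective : Function.Injective (mulMap T n u v) := by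
  classical
  have h := injective_of_linearIndependent_basis (tensorBasis T n)
    (orbitMap T n u v ∘ₗ mulMap T n u v) (linearIndependent_orbit T n u v)
  exact Function.Injective.of_comp (f := orbitMap T n u v) h

end Faithful

/-! ### Spanning and the basis theorem -/

section Spanning

theorem AnticommutesDiagonally.c_mul_x {F A : Type*} [Field F] [Ring A] [Algebra F A] {n : ℕ}
    {X C : Fin n → A} (h : AnticommutesDiagonally X C) (i j : Fin n) :
    C i * X j = (if j = i then (-1 : F) else 1) • (X j * C i) := by
  split_ifs with hij
  · rw [hij, h.same, neg_smul, one_smul, neg_neg]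
  · rw [h.ne j i hij, one_smul]

variable {F : Type*} [Field F] [Algebra ℂ F] (T : WeylType) (n : ℕ) (u v : F)

/-- An element that commutes with the `x_i` up to scalars and a permutation of the indices can be
moved past the polynomials in the `x_i`. -/
theorem exists_mul_xHom {h : Alg T n u v} {a : Fin n → F} {σ : Fin n → Fin n}
    (hx : ∀ i, h * x T u v i = a i • (x T u v (σ i) * h)) (p : MvPolynomial (Fin n) F) :
    ∃ q, h * xHom T n u v p = xHom T n u v q * h := by
  induction p using MvPolynomial.induction_on with
  | C r =>
    refine ⟨MvPolynomial.C r, ?_⟩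
    have e : (MvPolynomial.C r : MvPolynomial (Fin n) F) = algebraMap F _ r := rfl
    rw [e, AlgHom.commutes, Algebra.commutes]
  | add p q hp hq =>
    obtain ⟨p', hp⟩ := hp
    obtain ⟨q', hq⟩ := hq
    exact ⟨p' + q', by rw [map_add, map_add, mul_add, add_mul, hp, hq]⟩
  | mul_X p i hp =>
    obtain ⟨p', hp⟩ := hp
    refine ⟨a i • (p' * MvPolynomial.X (σ i)), ?_⟩
    rw [map_mul, ← mul_assoc, hp, mul_assoc, xHom_X, hx, map_smul, map_mul, xHom_X, mul_smul_comm,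
      smul_mul_assoc, mul_assoc]

/-- The `a` with this property form a subalgebra, so it is enough to treat the generators. -/
theorem exists_mul_cHom (w : weylGroup T n) (a : Cl F n) :
    ∃ b, g T u v w * cHom T n u v a = cHom T n u v b * g T u v w := by
  let P : Subalgebra F (Cl F n) :=
    { carrier := {a | ∃ b, g T u v w * cHom T n u v a = cHom T n u v b * g T u v w}
      mul_mem' := fun {a a'} ⟨b, hb⟩ ⟨b', hb'⟩ => ⟨b * b', by
        rw [map_mul, ← mul_assoc, hb, mul_assoc, hb', map_mul, mul_assoc]⟩
      add_mem' := fun {a a'} ⟨b, hb⟩ ⟨b', hb'⟩ => ⟨b + b', by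
        rw [map_add, map_add, mul_add, add_mul, hb, hb']⟩
      algebraMap_mem' := fun r => ⟨algebraMap F _ r, by
        rw [AlgHom.commutes, Algebra.commutes]⟩ }
  have hP : P = ⊤ := Cl.eq_top fun i =>
    ⟨((w.1.sgn i : ℤ) : F) • cl F (w.1.idx i), by
      rw [cHom_cl, (alg_family T u v).lower.cliffordWeyl.equivariant, map_smul, cHom_cl,
        smul_mul_assoc]⟩
  exact (hP ▸ Algebra.mem_top : a ∈ P)

theorem y_mul_cHom (i : Fin n) (a : Cl F n) :
    y T u v i * cHom T n u v a = cHom T n u v a * y T u v i := by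
  have hP : (Subalgebra.centralizer F {y T u v i}).comap (cHom T n u v) = ⊤ :=
    Cl.eq_top fun j => Subalgebra.mem_centralizer_iff F |>.2 fun z hz => by
      rw [Set.mem_singleton_iff.1 hz]
      change y T u v i * cHom T n u v (cl F j) = cHom T n u v (cl F j) * y T u v i
      rw [cHom_cl]
      exact (alg_family T u v).lower.comm_c i j
  have ha : a ∈ (Subalgebra.centralizer F {y T u v i}).comap (cHom T n u v) :=
    hP ▸ Algebra.mem_top
  exact (Subalgebra.mem_centralizer_iff F).1 ha _ rfl

/-- The span of the products `p a w q`. -/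
def pbwSpan : Submodule F (Alg T n u v) :=
  Submodule.span F {h | ∃ p a w q,
    h = xHom T n u v p * cHom T n u v a * g T u v w * yHom T n u v q}

theorem mem_pbwSpan (p : MvPolynomial (Fin n) F) (a : Cl F n) (w : weylGroup T n)
    (q : MvPolynomial (Fin n) F) :
    xHom T n u v p * cHom T n u v a * g T u v w * yHom T n u v q ∈ pbwSpan T n u v :=
  Submodule.subset_span ⟨p, a, w, q, rfl⟩

theorem mem_leftStabilizer_pbwSpan {h : Alg T n u v}
    (H : ∀ p a w q, h * (xHom T n u v p * cHom T n u v a * g T u v w * yHom T n u v q) ∈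
      pbwSpan T n u v) : h ∈ leftStabilizer (pbwSpan T n u v) := by
  intro z hz
  induction hz using Submodule.span_induction with
  | mem z hz =>
    obtain ⟨p, a, w, q, rfl⟩ := hz
    exact H p a w q
  | zero =>
    rw [mul_zero]
    exact Submodule.zero_mem _
  | add a b _ _ ha hb =>
    rw [mul_add]
    exact Submodule.add_mem _ ha hb
  | smul r a _ ha =>
    rw [mul_smul_comm]
    exact Submodule.smul_mem _ r ha

theorem x_mem_leftStabilizer (i : Fin n) : x T u v i ∈ leftStabilizer (pbwSpan T n u v) :=
  mem_leftStabilizer_pbwSpan T n u v fun p a w q => by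
    rw [← xHom_X, ← mul_assoc, ← mul_assoc, ← mul_assoc, ← map_mul]
    exact mem_pbwSpan T n u v _ a w q

theorem c_mem_leftStabilizer (i : Fin n) : c T u v i ∈ leftStabilizer (pbwSpan T n u v) :=
  mem_leftStabilizer_pbwSpan T n u v fun p a w q => by
    have hx : ∀ j, c T u v i * x T u v j =
        (if j = i then (-1 : F) else 1) • (x T u v j * c T u v i) :=
      fun j => (alg_family T u v).anti.c_mul_x i j
    obtain ⟨p', hp⟩ := exists_mul_xHom T n u v (σ := id) hx p
    rw [← mul_assoc, ← mul_assoc, ← mul_assoc, hp, mul_assoc (xHom T n u v p'), ← cHom_cl,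
      ← map_mul]
    exact mem_pbwSpan T n u v _ _ w q

theorem g_mem_leftStabilizer (z : weylGroup T n) :
    g T u v z ∈ leftStabilizer (pbwSpan T n u v) :=
  mem_leftStabilizer_pbwSpan T n u v fun p a w q => by
    obtain ⟨p', hp⟩ := exists_mul_xHom T n u v ((alg_family T u v).equivariant z) p
    obtain ⟨b, hb⟩ := exists_mul_cHom T n u v z a
    rw [← mul_assoc, ← mul_assoc, ← mul_assoc, hp, mul_assoc (xHom T n u v p'), hb, ← mul_assoc,
      mul_assoc _ (g T u v z), ← g_mul]
    exact mem_pbwSpan T n u v _ _ _ q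

theorem reflS_mem {P : Subalgebra F (Alg T n u v)} (h : ∀ w, g T u v w ∈ P) (i j : Fin n) :
    reflS T (g T u v) i j ∈ P := h _

theorem reflBar_mem {P : Subalgebra F (Alg T n u v)} (h : ∀ w, g T u v w ∈ P) (i j : Fin n) :
    reflBar T (g T u v) i j ∈ P := by
  cases T
  · exact P.zero_mem
  · exact h _
  · exact h _

theorem reflTau_mem {P : Subalgebra F (Alg T n u v)} (h : ∀ w, g T u v w ∈ P) (i : Fin n) :
    reflTau T (g T u v) i ∈ P := by
  cases T
  · exact P.zero_mem
  · exact P.zero_mem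
  · exact h _

/-- Applied to the left stabilizer of the span, this shows that multiplication by the commutators
`[y_j, x_i]` preserves the span once multiplication by the `c_i` and `w` does. -/
theorem weylKern_mem {P : Subalgebra F (Alg T n u v)} (hc : ∀ i, c T u v i ∈ P)
    (hg : ∀ w, g T u v w ∈ P) (u' v' : F) (j i : Fin n) :
    weylKern u' v' (c T u v) (g T u v) j i ∈ P := by
  have h1 : ∀ j i, eps (c T u v) (reflS T (g T u v)) j i ∈ P := fun j i =>
    P.mul_mem (P.add_mem P.one_mem (P.mul_mem (hc j) (hc i))) (reflS_mem T n u v hg j i)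
  have h2 : ∀ j i, epsBar (c T u v) (reflBar T (g T u v)) j i ∈ P := fun j i =>
    P.mul_mem (P.sub_mem P.one_mem (P.mul_mem (hc j) (hc i))) (reflBar_mem T n u v hg j i)
  rw [weylKern, kern]
  split_ifs
  · exact P.sub_mem (P.neg_mem (P.smul_mem (P.sum_mem fun k _ => P.add_mem (h1 k i) (h2 k i)) _))
      (P.smul_mem (reflTau_mem T n u v hg i) _)
  · exact P.smul_mem (P.sub_mem (h1 j i) (h2 j i)) _

theorem y_mul_g (j : Fin n) (w : weylGroup T n) :
    ∃ q, y T u v j * g T u v w = g T u v w * yHom T n u v q := by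
  refine ⟨((w⁻¹.1.sgn j : ℤ) : F) • MvPolynomial.X (w⁻¹.1.idx j), ?_⟩
  have h := (alg_family T u v).lower.equivariant w⁻¹ j
  have e : g T u v w * g T u v w⁻¹ = 1 := by rw [← g_mul, mul_inv_cancel, g_one]
  have e' : g T u v w⁻¹ * g T u v w = 1 := by rw [← g_mul, inv_mul_cancel, g_one]
  calc y T u v j * g T u v w = g T u v w * (g T u v w⁻¹ * y T u v j) * g T u v w := by
        rw [← mul_assoc, e, one_mul]
    _ = _ := by
        rw [h, map_smul, yHom_X, mul_smul_comm, smul_mul_assoc, mul_smul_comm, mul_assoc, mul_assoc,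
          e', mul_one]

/-- Induction on the polynomial `p` in front. For constant `p`, `y_j` passes the Clifford part
unchanged and becomes a linear form in the `y` behind `w`. For `x_i p`, the commutator term is an
element of the stabilizer applied to a product with the smaller factor `p`. -/
theorem y_mem_leftStabilizer (j : Fin n) : y T u v j ∈ leftStabilizer (pbwSpan T n u v) :=
  mem_leftStabilizer_pbwSpan T n u v fun p a w q => by
    -- Stated for all `p`, since the induction below varies it.
    have hm : ∀ p, xHom T n u v p * (cHom T n u v a * g T u v w * yHom T n u v q) ∈
        pbwSpan T n u v := by
      intro p
      rw [← mul_assoc, ← mul_assoc]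
      exact mem_pbwSpan T n u v p a w q
    have hk := weylKern_mem T n u v (c_mem_leftStabilizer T n u v) (g_mem_leftStabilizer T n u v) u
      (algebraMap ℂ F (Real.sqrt 2 : ℂ) * v) j
    rw [mul_assoc (_ * _), mul_assoc (xHom T n u v p), ← mul_assoc (cHom T n u v a)]
    induction p using MvPolynomial.induction_on with
    | C r =>
      obtain ⟨q', hq⟩ := y_mul_g T n u v j w
      have e : (MvPolynomial.C r : MvPolynomial (Fin n) F) = algebraMap F _ r := rfl
      rw [e, AlgHom.commutes, ← mul_assoc, ← Algebra.commutes, mul_assoc, ← Algebra.smul_def,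
        ← mul_assoc, ← mul_assoc, y_mul_cHom, mul_assoc (cHom T n u v a), hq, mul_assoc, mul_assoc,
        ← map_mul, ← mul_assoc]
      have h := mem_pbwSpan T n u v 1 a w (q' * q)
      rw [map_one, one_mul] at h
      exact Submodule.smul_mem _ r h
    | add p p' hp hp' =>
      rw [map_add, add_mul, mul_add]
      exact Submodule.add_mem _ hp hp'
    | mul_X p i hp =>
      have hyx : y T u v j * x T u v i = x T u v i * y T u v j +
          weylKern u (algebraMap ℂ F (Real.sqrt 2 : ℂ) * v) (c T u v) (g T u v) j i := by
        rw [← (alg_family T u v).commutator j i]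
        abel
      rw [mul_comm p, map_mul, xHom_X, mul_assoc, ← mul_assoc (y T u v j), hyx, add_mul,
        mul_assoc (x T u v i)]
      exact Submodule.add_mem _ (x_mem_leftStabilizer T n u v i _ hp) (hk i _ (hm p))

/-- The left stabilizer of the span is a subalgebra containing all generators, hence everything, and
the span contains `1`. -/
theorem pbwSpan_eq_top : pbwSpan T n u v = ⊤ := by
  refine eq_top_of_leftStabilizer (alg_induction (x_mem_leftStabilizer T n u v)
    (y_mem_leftStabilizer T n u v) (c_mem_leftStabilizer T n u v)
    (g_mem_leftStabilizer T n u v)) ?_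
  have h := mem_pbwSpan T n u v 1 1 1 1
  rwa [map_one, map_one, map_one, g_one, one_mul, one_mul, one_mul] at h

theorem mulMap_surjective : Function.Surjective (mulMap T n u v) := by
  rw [← LinearMap.range_eq_top, eq_top_iff, ← pbwSpan_eq_top, pbwSpan, Submodule.span_le]
  rintro _ ⟨p, a, w, q, rfl⟩
  refine ⟨((p ⊗ₜ a) ⊗ₜ MonoidAlgebra.of F (weylGroup T n) w) ⊗ₜ q, ?_⟩
  rw [mulMap_tmul, wHom_of]

end Spanning

/-! ### The PBW basis and injectivity of the four factors -/

section Basis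

variable {F : Type*} [Field F] [Algebra ℂ F] (T : WeylType) (n : ℕ) (u v : F)

omit [Algebra ℂ F] in
theorem map_monomial {A : Type*} [Ring A] [Algebra F A] (f : MvPolynomial (Fin n) F →ₐ[F] A)
    (α : Fin n →₀ ℕ) :
    f (MvPolynomial.monomial α 1) = (List.ofFn fun i => f (MvPolynomial.X i) ^ α i).prod := by
  rw [MvPolynomial.monomial_eq, MvPolynomial.C_1, one_mul, Finsupp.prod_fintype _ _ (by simp),
    ← List.prod_ofFn, map_list_prod, List.map_ofFn]
  simp [Function.comp_def]

theorem mulMap_tensorBasis_eq_pbw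
    (t : (((Fin n →₀ ℕ) × (Fin n → ZMod 2)) × weylGroup T n) × (Fin n →₀ ℕ)) :
    mulMap T n u v (tensorBasis T n t) = pbw T n u v (t.1.1.1, t.1.1.2, t.1.2, t.2) := by
  rw [mulMap_tensorBasis, map_monomial, map_monomial, map_cliffMon]
  simp only [xHom_X, yHom_X, cHom_cl]
  rfl

/-- The rearrangement of the index set of the tensor basis to that of the PBW basis. -/
def pbwIndex (W : Type*) :
    (((Fin n →₀ ℕ) × (Fin n → ZMod 2)) × W) × (Fin n →₀ ℕ) ≃
      (Fin n → ℕ) × (Fin n → ZMod 2) × W × (Fin n → ℕ) where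
  toFun t := (t.1.1.1, t.1.1.2, t.1.2, t.2)
  invFun t := (((Finsupp.equivFunOnFinite.symm t.1, t.2.1), t.2.2.1),
    Finsupp.equivFunOnFinite.symm t.2.2.2)
  left_inv t := by simp
  right_inv t := by simp

/-- The PBW basis. -/
def pbwBasis : Module.Basis ((Fin n → ℕ) × (Fin n → ZMod 2) × weylGroup T n × (Fin n → ℕ)) F
    (Alg T n u v) :=
  ((tensorBasis T n).map (LinearEquiv.ofBijective (mulMap T n u v)
    ⟨mulMap_injective T n u v, mulMap_surjective T n u v⟩)).reindex (pbwIndex n (weylGroup T n))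

theorem pbwBasis_apply (t : (Fin n → ℕ) × (Fin n → ZMod 2) × weylGroup T n × (Fin n → ℕ)) :
    pbwBasis T n u v t = pbw T n u v t := by
  rw [pbwBasis, Module.Basis.reindex_apply, Module.Basis.map_apply]
  refine (mulMap_tensorBasis_eq_pbw T n u v _).trans (congrArg _ ?_)
  exact (pbwIndex n (weylGroup T n)).apply_symm_apply t

omit [Algebra ℂ F] in
-- Over a field every module is flat, so tensoring the inclusion `F → B` with `V` stays injective.
theorem tmul_one_injective {V B : Type*} [AddCommGroup V] [Module F V] [Ring B] [Algebra F B]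
    [Nontrivial B] : Function.Injective fun a : V => a ⊗ₜ[F] (1 : B) := by
  have h := Module.Flat.lTensor_preserves_injective_linearMap (M := V) (Algebra.linearMap F B)
    (algebraMap F B).injective
  have e : (fun a : V => a ⊗ₜ[F] (1 : B)) =
      (Algebra.linearMap F B).lTensor V ∘ (TensorProduct.rid F V).symm := by
    funext a
    simp
  rw [e]
  exact h.comp (LinearEquiv.injective _)

omit [Algebra ℂ F] in
theorem one_tmul_injective {V B : Type*} [AddCommGroup V] [Module F V] [Ring B] [Algebra F B]
    [Nontrivial B] : Function.Injective fun a : V => (1 : B) ⊗ₜ[F] a := by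
  intro a b h
  exact tmul_one_injective (F := F) (B := B) (congrArg (TensorProduct.comm F B V) h)

instance : Nontrivial (Cl F n) :=
  ⟨⟨1, 0, by
    rw [← cliffMon_zero (cl F)]
    exact linearIndependent_cliffMon.ne_zero 0⟩⟩

/-- The map is `mulMap` restricted to `p ⊗ 1 ⊗ 1 ⊗ 1`, and tensoring with `1` is injective. The
other three factors are treated in the same way. -/
theorem xHom_injective : Function.Injective (xHom T n u v) := by
  intro p p' h
  refine tmul_one_injective (F := F) (B := Cl F n)
    (tmul_one_injective (F := F) (B := MonoidAlgebra F (weylGroup T n))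
      (tmul_one_injective (F := F) (B := MvPolynomial (Fin n) F) (mulMap_injective T n u v ?_)))
  simp only [mulMap_tmul, h]

theorem cHom_injective : Function.Injective (cHom T n u v) := by
  intro a a' h
  refine one_tmul_injective (F := F) (B := MvPolynomial (Fin n) F)
    (tmul_one_injective (F := F) (B := MonoidAlgebra F (weylGroup T n))
      (tmul_one_injective (F := F) (B := MvPolynomial (Fin n) F) (mulMap_injective T n u v ?_)))
  simp only [mulMap_tmul, h]

theorem wHom_injective : Function.Injective (wHom T n u v) := by
  intro b b' h
  refine one_tmul_injective (F := F) (B := MvPolynomial (Fin n) F ⊗[F] Cl F n)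
    (tmul_one_injective (F := F) (B := MvPolynomial (Fin n) F) (mulMap_injective T n u v ?_))
  -- The unit of the tensor product algebra is unfolded to a pure tensor so that `mulMap_tmul`
  -- applies.
  change mulMap T n u v (((1 ⊗ₜ 1) ⊗ₜ b) ⊗ₜ 1) = mulMap T n u v (((1 ⊗ₜ 1) ⊗ₜ b') ⊗ₜ 1)
  simp only [mulMap_tmul, h]

theorem yHom_injective : Function.Injective (yHom T n u v) := by
  intro q q' h
  refine one_tmul_injective (F := F)
    (B := (MvPolynomial (Fin n) F ⊗[F] Cl F n) ⊗[F] MonoidAlgebra F (weylGroup T n))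
    (mulMap_injective T n u v ?_)
  change mulMap T n u v (((1 ⊗ₜ 1) ⊗ₜ 1) ⊗ₜ q) = mulMap T n u v (((1 ⊗ₜ 1) ⊗ₜ 1) ⊗ₜ q')
  simp only [mulMap_tmul, h]

end Basis

end DaHCa

end

/-- PBW theorem for the rational double affine Hecke–Clifford algebras of types `A_{n-1}`, `D_n`
and `B_n`, over `ℂ` or any field extension `F` of `ℂ` (such as `ℂ(u)` or `ℂ(u, v)`). -/
theorem theorem3p5 {F : Type*} [Field F] [Algebra ℂ F] (T : DaHCa.WeylType) (n : ℕ) (u v : F) :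
    (Function.Injective (DaHCa.xHom T n u v) ∧ Function.Injective (DaHCa.cHom T n u v) ∧
      Function.Injective (DaHCa.wHom T n u v) ∧ Function.Injective (DaHCa.yHom T n u v)) ∧
    Function.Bijective (DaHCa.mulMap T n u v) ∧
    ∃ b : Module.Basis
        ((Fin n → ℕ) × (Fin n → ZMod 2) × DaHCa.weylGroup T n × (Fin n → ℕ)) F
        (DaHCa.Alg T n u v),
      ∀ t, b t = DaHCa.pbw T n u v t :=
  ⟨⟨DaHCa.xHom_injective T n u v, DaHCa.cHom_injective T n u v, DaHCa.wHom_injective T n u v,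
      DaHCa.yHom_injective T n u v⟩,
    ⟨DaHCa.mulMap_injective T n u v, DaHCa.mulMap_surjective T n u v⟩,
    DaHCa.pbwBasis T n u v, DaHCa.pbwBasis_apply T n u v⟩
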